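/- Let $\Delta\subset\mathbb C$ be the open unit disk. For real $m>0$ let $H^m$ be the space of holomorphic differentials $f(z)(dz)^m$ on $\Delta$, $f=\sum_{k\ge 0}f_kz^k$, with the topology of uniform convergence on compact sets and its Borel structure. Put $$B(k+1,2m):=\frac{\Gamma(k+1)\Gamma(2m)}{\Gamma(2m+k)}\qquad(k\ge 0)$$ (this is the meaning of $B(\cdot,\cdot)$ throughout), and let $H^m\cap L^2\subset H^m$ be the Hilbert space with norm $|f|^2=\sum_k|f_k|^2B(k+1,2m)$. For $T>0$ let $\nu_T^{(m)}$ be the Gaussian probability measure on $H^m$ for which the Taylor coefficients $f_k$ are independent complex random variables with densities $\frac{B(k+1,2m)}{2\pi T}e^{-\frac1{2T}B(k+1,2m)|f_k|^2}$. For probability measures $\nu$ on $H^m$ and $\mu$ on $H^n$ let $\nu\otimes\mu$, the multiplicative image, be the image of $\nu\times\mu$ under the multiplication $H^m\times H^n\to H^{m+n}$, $(f(dz)^m,g(dz)^n)\mapsto fg(dz)^{m+n}$. The Fourier transform of a probability measure $\nu$ on $H^m$ at a polynomial differential $F$ is $\hat\nu(F)=\int e^{-i\,\mathrm{Re}\langle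 F,f\rangle}\,d\nu(f)$, where $\langle F,f\rangle=\sum_kF_k\bar f_kB(k+1,2m)$; at a general $F\in H^m\cap L^2$ it is understood by continuous extension in $F$, equivalently as the same integral with $\langle F,f\rangle$ the limit in $\nu$-measure of its partial sums. Let $m,n>0$ and $S,T>0$ be real. For $F\in H^{m+n}\cap L^2$ let $B(m,n;F)$ be the generalized Hankel operator from the conjugate space of $H^m\cap L^2$ to $H^n\cap L^2$ whose matrix, relative to the orthogonal bases $\bar z^{\,j}$ and $z^k$ ($j,k\ge 0$), has the entries $$B(m,n;F)_{j,k}=F_{k+j}\,\frac{B(k+j+1,2m+2n)}{B(k+1,2n)},$$ that is, it maps $\sum_j\bar f_j\bar z^{\,j}$ to $\sum_k\big(\sum_jB(m,n;F)_{j,k}\bar f_j\big)z^k$. Then $B(m,n;F)$ is a Hilbert–Schmidt operator, the Fredholm determinant below converges absolutely (as the sum of the principal minors in the orthonormal basis $z^k/\sqrt{B(k+1,2n)}$ of $H^n\cap L^2$), the Fourier transform of $\nu_S^{(m)}\otimes\nu_T^{(n)}$ extends continuously to $H^{m+n}\cap L^2$, and for all $F\in H^{m+n}\cap L^2$ $$(\nu_S^{(m)}\otimes\nu_T^{(n)})^{\wedge}(F)=\frac1{\det\big(1+ST\,B(m,n;F)B(m,n;F)^*\big)}.$$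 -/

import Mathlib

open MeasureTheory ProbabilityTheory Filter Topology
open scoped NNReal ENNReal ComplexConjugate

noncomputable section

namespace Disk

/-! ### Holomorphic differentials on the unit disk -/

/-- Extension by zero of a function on the open unit disk. -/
def ext (f : C(Metric.ball (0 : ℂ) 1, ℂ)) : ℂ → ℂ :=
  Function.extend Subtype.val f 0

theorem ext_apply (f : C(Metric.ball (0 : ℂ) 1, ℂ)) (z : Metric.ball (0 : ℂ) 1) :
    ext f z = f z :=
  Subtype.val_injective.extend_apply _ _ _

theorem ext_eqOn {f : C(Metric.ball (0 : ℂ) 1, ℂ)} {g : ℂ → ℂ}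
    (h : ∀ z : Metric.ball (0 : ℂ) 1, f z = g z) : Set.EqOn (ext f) g (Metric.ball 0 1) :=
  fun z hz => (ext_apply f ⟨z, hz⟩).trans (h ⟨z, hz⟩)

/-- The holomorphic functions on the open unit disk. -/
def holomorphic : Submodule ℂ C(Metric.ball (0 : ℂ) 1, ℂ) where
  carrier := {f | DifferentiableOn ℂ (ext f) (Metric.ball 0 1)}
  add_mem' {f g} hf hg := (hf.add hg).congr
    (ext_eqOn fun z => by simp [ext_apply])
  zero_mem' := (differentiableOn_const (0 : ℂ)).congr (ext_eqOn fun z => by simp)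
  smul_mem' c f hf := (hf.const_smul c).congr (ext_eqOn fun z => by simp [ext_apply])

/-- `HDiff m` is the space `H^m` of holomorphic differentials `f(z)(dz)^m` of degree `m` on the
unit disk, such a differential being identified with the holomorphic function `f`. -/
def HDiff (_m : ℝ) : Type := holomorphic

instance (m : ℝ) : AddCommGroup (HDiff m) := inferInstanceAs (AddCommGroup holomorphic)

instance (m : ℝ) : Module ℂ (HDiff m) := inferInstanceAs (Module ℂ holomorphic)

/-- The topology of uniform convergence on compact sets. -/
instance (m : ℝ) : TopologicalSpace (HDiff m) := inferInstanceAs (TopologicalSpace holomorphic)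

/-- The Borel structure of `H^m`. -/
instance (m : ℝ) : MeasurableSpace (HDiff m) := borel _

instance (m : ℝ) : BorelSpace (HDiff m) := ⟨rfl⟩

/-- The multiplication `(f(z)(dz)^m, g(z)(dz)^n) ↦ f(z)g(z)(dz)^(m+n)`. -/
def mulDiff (m n : ℝ) (p : HDiff m × HDiff n) : HDiff (m + n) :=
  ⟨p.1.1 * p.2.1, (DifferentiableOn.mul p.1.2 p.2.2).congr
    (ext_eqOn fun z => by simp [ext_apply])⟩

/-- The Taylor coefficient `f_k` of `f(z)(dz)^m`, where `f(z) = ∑ f_k z^k`. -/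
def coeff {m : ℝ} (f : HDiff m) (k : ℕ) : ℂ :=
  ((k.factorial : ℂ))⁻¹ * iteratedDeriv k (ext f.1) 0

/-- The power series `∑ a_k z^k` converges in the whole unit disk. -/
def Converges (a : ℕ → ℂ) : Prop :=
  ∀ r : ℝ, 0 ≤ r → r < 1 → Summable fun k => ‖a k‖ * r ^ k

theorem Converges.hasFPowerSeriesOnBall {a : ℕ → ℂ} (h : Converges a) :
    HasFPowerSeriesOnBall (fun z => ∑' k, a k * z ^ k)
      (FormalMultilinearSeries.ofScalars ℂ a) 0 1 where
  r_le := by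
    refine ENNReal.le_of_forall_nnreal_lt fun r hr => ?_
    refine FormalMultilinearSeries.le_radius_of_summable_norm _ ?_
    refine (h r r.2 (by exact_mod_cast hr)).of_nonneg_of_le (fun k => by positivity) fun k => ?_
    gcongr
    exact (FormalMultilinearSeries.ofScalars_norm ℂ a k).le
  r_pos := by simp
  hasSum := by
    intro y hy
    have hy' : ‖y‖ < 1 := by simpa [Metric.eball, edist_zero_right, ← ofReal_norm] using hy
    have : Summable fun k => a k * y ^ k := by
      refine Summable.of_norm ?_
      simpa using h ‖y‖ (norm_nonneg _) hy'
    simpa [FormalMultilinearSeries.ofScalars, List.prod_ofFn] using this.hasSum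

theorem Converges.differentiableOn {a : ℕ → ℂ} (h : Converges a) :
    DifferentiableOn ℂ (fun z => ∑' k, a k * z ^ k) (Metric.ball 0 1) := by
  have := h.hasFPowerSeriesOnBall.differentiableOn
  rwa [show Metric.eball (0 : ℂ) 1 = Metric.ball 0 1 by
    simpa using (Metric.eball_ofReal (x := (0:ℂ)) (ε := 1))] at this

open Classical in
/-- The differential `(∑ a_k z^k)(dz)^m`, if the series converges in the unit disk (and `0`
otherwise). -/
def taylorSeries (m : ℝ) (a : ℕ → ℂ) : HDiff m :=
  if h : Converges a then
    ⟨⟨fun z => ∑' k, a k * (z : ℂ) ^ k, h.differentiableOn.continuousOn.domRestrict⟩,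
      h.differentiableOn.congr (ext_eqOn fun _ => rfl)⟩
  else 0

theorem coeff_taylorSeries (m : ℝ) {a : ℕ → ℂ} (h : Converges a) (k : ℕ) :
    coeff (taylorSeries m a) k = a k := by
  have h1 : HasFPowerSeriesAt (ext (taylorSeries m a).1)
      (FormalMultilinearSeries.ofScalars ℂ a) 0 := by
    refine h.hasFPowerSeriesOnBall.hasFPowerSeriesAt.congr ?_
    filter_upwards [Metric.ball_mem_nhds (0 : ℂ) one_pos] with z hz
    rw [show ext (taylorSeries m a).1 z = (taylorSeries m a).1 ⟨z, hz⟩ from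
      ext_apply (taylorSeries m a).1 ⟨z, hz⟩]
    rw [show taylorSeries m a = _ from dif_pos h]
    rfl
  have h2 := h1.eq_formalMultilinearSeries h1.analyticAt.hasFPowerSeriesAt
  have h3 := congrArg (fun p => FormalMultilinearSeries.coeff p k) h2
  simp only [FormalMultilinearSeries.coeff_ofScalars] at h3
  rw [coeff, h3, div_eq_inv_mul]

theorem hasSum_coeff {m : ℝ} (f : HDiff m) (z : Metric.ball (0 : ℂ) 1) :
    HasSum (fun k => coeff f k * (z : ℂ) ^ k) (f.1 z) := by
  have h := Complex.hasSum_taylorSeries_on_ball f.2 z.2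
  rw [ext_apply] at h
  refine h.congr_fun fun k => ?_
  simp only [coeff, sub_zero, smul_eq_mul]
  ring

theorem contDiffAt_ext {m : ℝ} (f : HDiff m) (k : ℕ) : ContDiffAt ℂ k (ext f.1) 0 :=
  (DifferentiableOn.contDiffOn f.2 Metric.isOpen_ball).contDiffAt
    (Metric.ball_mem_nhds (0 : ℂ) one_pos)

theorem iteratedDeriv_ext_congr {f : C(Metric.ball (0 : ℂ) 1, ℂ)} {g : ℂ → ℂ}
    (h : ∀ z : Metric.ball (0 : ℂ) 1, f z = g z) (k : ℕ) :
    iteratedDeriv k (ext f) 0 = iteratedDeriv k g 0 :=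
  Filter.EventuallyEq.iteratedDeriv_eq k
    ((ext_eqOn h).eventuallyEq_of_mem (Metric.ball_mem_nhds (0 : ℂ) one_pos))

theorem coeff_add {m : ℝ} (f g : HDiff m) (k : ℕ) : coeff (f + g) k = coeff f k + coeff g k := by
  rw [coeff, iteratedDeriv_ext_congr (g := ext f.1 + ext g.1)
      (fun z => by simp only [Pi.add_apply, ext_apply]; rfl),
    iteratedDeriv_add (contDiffAt_ext f k) (contDiffAt_ext g k), mul_add]
  rfl

theorem coeff_smul {m : ℝ} (c : ℂ) (f : HDiff m) (k : ℕ) : coeff (c • f) k = c * coeff f k := by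
  rw [coeff, iteratedDeriv_ext_congr (g := c • ext f.1)
      (fun z => by simp only [Pi.smul_apply, ext_apply]; rfl),
    iteratedDeriv_const_smul (contDiffAt_ext f k), coeff, smul_eq_mul]
  ring

theorem coeff_zero {m : ℝ} (k : ℕ) : coeff (0 : HDiff m) k = 0 := by
  simpa using coeff_smul 0 (0 : HDiff m) k

theorem coeff_injective {m : ℝ} {f g : HDiff m} (h : ∀ k, coeff f k = coeff g k) : f = g := by
  refine Subtype.ext (ContinuousMap.ext fun z => ?_)
  refine (hasSum_coeff f z).unique ?_
  simp only [h]
  exact hasSum_coeff g z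

/-! ### The Hilbert space `H^m ∩ L²`, `m > 0` -/

instance (m n : ℝ) [hm : Fact (0 < m)] [hn : Fact (0 < n)] : Fact (0 < m + n) :=
  ⟨add_pos hm.out hn.out⟩

/-- The squared norm of `z^k (dz)^m`, namely `Γ(k+1)Γ(2m)/Γ(2m+k)`.  This is the number written
`B(k+1, 2m)`. -/
def weight (m : ℝ) (k : ℕ) : ℝ :=
  Real.Gamma (k + 1) * Real.Gamma (2 * m) / Real.Gamma (2 * m + k)

section Weight

variable (m : ℝ) [hm : Fact (0 < m)]

theorem weight_pos (k : ℕ) : 0 < weight m k := by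
  have := hm.out
  unfold weight
  have h1 := Real.Gamma_pos_of_pos (s := (k : ℝ) + 1) (by positivity)
  have h2 := Real.Gamma_pos_of_pos (s := 2 * m) (by positivity)
  have h3 := Real.Gamma_pos_of_pos (s := 2 * m + k) (by positivity)
  positivity

theorem weight_zero : weight m 0 = 1 := by
  have := hm.out
  have h2 := Real.Gamma_pos_of_pos (s := 2 * m) (by positivity)
  simp [weight, h2.ne']

theorem weight_succ (k : ℕ) : weight m (k + 1) = weight m k * ((k + 1) / (2 * m + k)) := by
  have := hm.out
  have h3 := Real.Gamma_pos_of_pos (s := 2 * m + k) (by positivity)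
  have h4 : (0 : ℝ) < 2 * m + k := by positivity
  unfold weight
  push_cast
  rw [Real.Gamma_add_one (s := (k : ℝ) + 1) (by positivity), ← add_assoc,
    Real.Gamma_add_one (s := 2 * m + k) (by positivity)]
  field_simp

theorem inv_weight_eq (k : ℕ) : (weight m k)⁻¹ = (-1) ^ k * Ring.choose (-(2 * m)) k := by
  induction k with
  | zero => simp [weight_zero]
  | succ k ih =>
    have := hm.out
    have h4 : (0 : ℝ) < 2 * m + k := by positivity
    have hc := Ring.choose_smul_choose (-(2 * m)) (Nat.le_succ k)
    rw [weight_succ, mul_inv, ih, inv_div]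
    simp at hc
    field_simp
    rw [pow_succ]
    linear_combination (-1) ^ k * hc

/-- The Chu-Vandermonde identity. -/
theorem sum_inv_weight (n : ℝ) [Fact (0 < n)] (l : ℕ) :
    ∑ p ∈ Finset.HasAntidiagonal.antidiagonal l, (weight m p.1)⁻¹ * (weight n p.2)⁻¹ = (weight (m + n) l)⁻¹ := by
  rw [inv_weight_eq, show -(2 * (m + n)) = -(2 * m) + -(2 * n) by ring,
    Ring.add_choose_eq l (Commute.all _ _), Finset.mul_sum]
  refine Finset.sum_congr rfl fun p hp => ?_
  rw [inv_weight_eq, inv_weight_eq, ← Finset.HasAntidiagonal.mem_antidiagonal.mp hp, pow_add]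
  ring

theorem summable_inv_weight (r : ℝ) (h0 : 0 ≤ r) (h1 : r < 1) :
    Summable fun k => (weight m k)⁻¹ * r ^ k := by
  have hw := fun k => (weight_pos m k).ne'
  obtain ⟨s, hs, hs1⟩ := exists_between h1
  have hs0 : 0 < s := h0.trans_lt hs
  have key : Summable fun k => (weight m k)⁻¹ * s ^ k := by
    refine summable_of_ratio_test_tendsto_lt_one hs1
      (Eventually.of_forall fun k => mul_ne_zero (inv_ne_zero (hw k)) (by positivity)) ?_
    have hlim : Tendsto (fun k : ℕ => s * ((2 * m + k) / (k + 1))) atTop (𝓝 s) := by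
      have h2 : Tendsto (fun k : ℕ => 1 + (2 * m - 1) * (1 / ((k : ℝ) + 1))) atTop
          (𝓝 (1 + (2 * m - 1) * 0)) :=
        (tendsto_one_div_add_atTop_nhds_zero_nat.const_mul _).const_add _
      have h3 := h2.const_mul s
      simp only [mul_zero, add_zero, mul_one] at h3
      refine h3.congr fun k => ?_
      field_simp
      ring
    refine hlim.congr fun k => ?_
    have hp := weight_pos m k
    have hp' := weight_pos m (k + 1)
    have := hm.out
    have h4 : (0 : ℝ) < 2 * m + k := by positivity
    rw [Real.norm_of_nonneg (by positivity), Real.norm_of_nonneg (by positivity), weight_succ, pow_succ]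
    field_simp
  refine key.of_nonneg_of_le (fun k => ?_) fun k => ?_
  · have := weight_pos m k
    positivity
  · have := weight_pos m k
    gcongr

theorem converges_of_summable {a : ℕ → ℂ} (h : Summable fun k => ‖a k‖ ^ 2 * weight m k) :
    Converges a := by
  intro r h0 h1
  have hg : Summable fun k => r ^ k := summable_geometric_of_lt_one h0 h1
  refine ((h.add hg).add (summable_inv_weight m r h0 h1)).of_nonneg_of_le
    (fun k => by positivity) fun k => ?_
  have hp := weight_pos m k
  have hr : r ^ k ≤ 1 := pow_le_one₀ h0 h1.le
  have hr0 : 0 ≤ r ^ k := by positivity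
  have h3 : ‖a k‖ ≤ ‖a k‖ ^ 2 * weight m k + (weight m k)⁻¹ := by
    have : 0 ≤ (‖a k‖ * weight m k - 1 / 2) ^ 2 * (weight m k)⁻¹ := by positivity
    have e : (‖a k‖ * weight m k - 1 / 2) ^ 2 * (weight m k)⁻¹ =
      ‖a k‖ ^ 2 * weight m k - ‖a k‖ + (weight m k)⁻¹ / 4 := by field_simp; ring
    have : 0 < (weight m k)⁻¹ := by positivity
    linarith
  have h4 : ‖a k‖ ^ 2 * weight m k * r ^ k ≤ ‖a k‖ ^ 2 * weight m k :=
    mul_le_of_le_one_right (by positivity) hr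
  nlinarith [mul_le_mul_of_nonneg_right h3 hr0]

/-- The space of all `f(z)(dz)^m` with `∑ |f_k|² B(k+1, 2m) < ∞`, as a subspace of `H^m`. -/
def l2Submodule : Submodule ℂ (HDiff m) where
  carrier := {f | Summable fun k => ‖coeff f k‖ ^ 2 * weight m k}
  add_mem' {f g} hf hg := by
    refine ((hf.add hg).mul_left 2).of_nonneg_of_le (fun k => ?_) fun k => ?_
    · have := weight_pos m k
      positivity
    · have h1 := weight_pos m k
      have h2 : ‖coeff (f + g) k‖ ^ 2 ≤ 2 * (‖coeff f k‖ ^ 2 + ‖coeff g k‖ ^ 2) := by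
        rw [coeff_add]
        have := norm_add_le (coeff f k) (coeff g k)
        nlinarith [norm_nonneg (coeff f k + coeff g k), sq_nonneg (‖coeff f k‖ - ‖coeff g k‖)]
      nlinarith
  zero_mem' := by simp [coeff_zero]
  smul_mem' c f hf := by
    refine (Summable.mul_left (‖c‖ ^ 2) hf).congr fun k => ?_
    rw [coeff_smul, norm_mul]
    ring

/-- The Hilbert space `H^m ∩ L²`.  (A type of its own, because it carries the topology of the norm
and not the one of `HDiff m`.) -/
def HL2 : Type := l2Submodule m

namespace HL2

instance : AddCommGroup (HL2 m) := inferInstanceAs (AddCommGroup (l2Submodule m))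

instance : Module ℂ (HL2 m) := inferInstanceAs (Module ℂ (l2Submodule m))

variable {m}

/-- The differential underlying an element of `H^m ∩ L²`. -/
def toDiff (f : HL2 m) : HDiff m := Subtype.val f

/-- The Taylor coefficients of an element of `H^m ∩ L²`. -/
def coeff (f : HL2 m) (k : ℕ) : ℂ := Disk.coeff f.toDiff k

theorem coeff_add (f g : HL2 m) (k : ℕ) : (f + g).coeff k = f.coeff k + g.coeff k :=
  Disk.coeff_add _ _ k

theorem coeff_smul (c : ℂ) (f : HL2 m) (k : ℕ) : (c • f).coeff k = c * f.coeff k :=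
  Disk.coeff_smul _ _ k

theorem summable (f : HL2 m) : Summable fun k => ‖f.coeff k‖ ^ 2 * weight m k := f.2

theorem ext_coeff {f g : HL2 m} (h : ∀ k, f.coeff k = g.coeff k) : f = g :=
  Subtype.ext (coeff_injective h)

variable (m) in
/-- The element `(∑ a_k z^k)(dz)^m` of `H^m ∩ L²`. -/
def ofCoeff (a : ℕ → ℂ) (h : Summable fun k => ‖a k‖ ^ 2 * weight m k) : HL2 m :=
  ⟨taylorSeries m a, by
    change Summable _
    simpa only [coeff_taylorSeries m (converges_of_summable m h)] using h⟩

@[simp] theorem coeff_ofCoeff (a : ℕ → ℂ) (h : Summable fun k => ‖a k‖ ^ 2 * weight m k) (k : ℕ) :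
    (ofCoeff m a h).coeff k = a k :=
  coeff_taylorSeries m (converges_of_summable m h) k

theorem sqrt_weight_ne (k : ℕ) : ((Real.sqrt (weight m k) : ℝ) : ℂ) ≠ 0 := by
  exact_mod_cast (Real.sqrt_pos.mpr (weight_pos m k)).ne'

theorem norm_sqrt_weight_mul (c : ℂ) (k : ℕ) :
    ‖(Real.sqrt (weight m k) : ℂ) * c‖ ^ 2 = ‖c‖ ^ 2 * weight m k := by
  rw [norm_mul, mul_pow, Complex.norm_real, Real.norm_of_nonneg (Real.sqrt_nonneg _),
    Real.sq_sqrt (weight_pos m k).le, mul_comm]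

/-- Coordinates with respect to the monomials `z^k (dz)^m / √B(k+1, 2m)`. -/
def toSeq : HL2 m ≃ₗ[ℂ] lp (fun _ : ℕ => ℂ) 2 where
  toFun f := ⟨fun k => (Real.sqrt (weight m k) : ℂ) * f.coeff k, memℓp_gen (by
    simpa only [ENNReal.toReal_ofNat, Real.rpow_ofNat, norm_sqrt_weight_mul] using f.summable)⟩
  map_add' f g := by
    ext k
    simp only [coeff_add, mul_add]
    rfl
  map_smul' c f := by
    ext k
    simp [coeff_smul, mul_left_comm]
  invFun x := ofCoeff m (fun k => (Real.sqrt (weight m k) : ℂ)⁻¹ * x k) (by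
    have := (memℓp_gen_iff (by simp)).mp (lp.memℓp x)
    simp only [ENNReal.toReal_ofNat, Real.rpow_ofNat] at this
    refine this.congr fun k => ?_
    rw [← norm_sqrt_weight_mul, mul_inv_cancel_left₀ (sqrt_weight_ne k)])
  left_inv f := ext_coeff fun k => by
    simp [inv_mul_cancel_left₀ (sqrt_weight_ne (m := m) k)]
  right_inv x := by
    ext k
    simp [mul_inv_cancel_left₀ (sqrt_weight_ne (m := m) k)]

instance : NormedAddCommGroup (HL2 m) :=
  NormedAddCommGroup.induced (HL2 m) (lp (fun _ : ℕ => ℂ) 2) toSeq.toLinearMap toSeq.injective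

theorem norm_toSeq (f : HL2 m) : ‖toSeq f‖ = ‖f‖ := rfl

theorem toSeq_apply (f : HL2 m) (k : ℕ) :
    toSeq f k = (Real.sqrt (weight m k) : ℂ) * f.coeff k := rfl

theorem inner_toSeq (f g : HL2 m) :
    ∑' k, conj (f.coeff k) * g.coeff k * weight m k = inner ℂ (toSeq f) (toSeq g) := by
  rw [lp.inner_eq_tsum]
  refine tsum_congr fun k => ?_
  have h : (weight m k : ℂ) = (Real.sqrt (weight m k) : ℂ) * Real.sqrt (weight m k) := by
    rw [← Complex.ofReal_mul, Real.mul_self_sqrt (weight_pos m k).le]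
  rw [RCLike.inner_apply, toSeq_apply, toSeq_apply, map_mul, Complex.conj_ofReal, h]
  ring

/-- The inner product is `∑ B(k+1, 2m) conj(f_k) g_k`, conjugate-linear in the first variable. -/
instance : InnerProductSpace ℂ (HL2 m) where
  norm_smul_le c f := by
    rw [← norm_toSeq, ← norm_toSeq, map_smul, norm_smul]
  inner f g := ∑' k, conj (f.coeff k) * g.coeff k * weight m k
  norm_sq_eq_re_inner f := by
    rw [inner_toSeq, ← norm_toSeq]
    exact norm_sq_eq_re_inner (𝕜 := ℂ) (toSeq f)
  conj_inner_symm f g := by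
    change conj (∑' k, conj (g.coeff k) * f.coeff k * weight m k : ℂ) =
      ∑' k, conj (f.coeff k) * g.coeff k * weight m k
    rw [inner_toSeq, inner_toSeq, inner_conj_symm]
  add_left f g h := by
    change ∑' k, conj ((f + g).coeff k) * h.coeff k * weight m k =
      ∑' k, conj (f.coeff k) * h.coeff k * weight m k +
      ∑' k, conj (g.coeff k) * h.coeff k * weight m k
    rw [inner_toSeq, inner_toSeq, inner_toSeq, map_add, inner_add_left]
  smul_left f g c := by
    change ∑' k, conj ((c • f).coeff k) * g.coeff k * weight m k =
      conj c * ∑' k, conj (f.coeff k) * g.coeff k * weight m k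
    rw [inner_toSeq, inner_toSeq, map_smul, inner_smul_left]

theorem norm_sq_eq (f : HL2 m) : ‖f‖ ^ 2 = ∑' k, ‖f.coeff k‖ ^ 2 * weight m k := by
  rw [← norm_toSeq, ← Real.rpow_two]
  have := lp.norm_rpow_eq_tsum (p := 2) (by simp) (toSeq f)
  simpa only [ENNReal.toReal_ofNat, Real.rpow_ofNat, toSeq_apply, norm_sqrt_weight_mul] using this

/-- `H^m ∩ L²` is isometric to `ℓ²`. -/
def toSeqₗᵢ : HL2 m ≃ₗᵢ[ℂ] lp (fun _ : ℕ => ℂ) 2 := ⟨toSeq, norm_toSeq⟩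

instance : CompleteSpace (HL2 m) :=
  (completeSpace_congr (e := (toSeqₗᵢ (m := m)).toEquiv)
    (toSeqₗᵢ (m := m)).isometry.isUniformInducing.isUniformEmbedding).mpr inferInstance

variable (m) in
/-- The orthonormal basis of `H^m ∩ L²` that consists of the monomials
`z^k (dz)^m / √B(k+1, 2m)`. -/
def basis : HilbertBasis ℕ ℂ (HL2 m) := .ofRepr toSeqₗᵢ

end HL2

end Weight

/-! ### The generalized Hankel operator -/

section Hankel

variable (m n : ℝ) [Fact (0 < m)] [Fact (0 < n)]

/-- The entries `F_{k+j} B(k+j+1, 2m+2n) / B(k+1, 2n)` of the matrix of `B(m, n; F)` relative to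
the orthogonal bases `z^j (dz)^m` and `z^k (dz)^n`. -/
def hankelEntry (F : HL2 (m + n)) (j k : ℕ) : ℂ :=
  F.coeff (k + j) * ((weight (m + n) (k + j) / weight n k : ℝ) : ℂ)

theorem summable_hankelEntry (F : HL2 (m + n)) :
    Summable fun p : ℕ × ℕ =>
      ‖hankelEntry m n F p.1 p.2‖ ^ 2 * (weight m p.1)⁻¹ * weight n p.2 := by
  have h0 : ∀ p : ℕ × ℕ, ‖hankelEntry m n F p.1 p.2‖ ^ 2 * (weight m p.1)⁻¹ * weight n p.2 =
      ‖F.coeff (p.1 + p.2)‖ ^ 2 * weight (m + n) (p.1 + p.2) ^ 2 *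
        ((weight m p.1)⁻¹ * (weight n p.2)⁻¹) := by
    intro p
    have h1 := weight_pos n p.2
    have h2 := weight_pos (m + n) (p.2 + p.1)
    rw [hankelEntry, norm_mul, Complex.norm_real, Real.norm_of_nonneg (by positivity),
      add_comm p.1 p.2]
    field_simp
  rw [← Finset.HasAntidiagonal.sigmaAntidiagonalEquivProd.summable_iff, summable_sigma_of_nonneg]
  · refine ⟨fun l => (hasSum_fintype _).summable, F.summable.congr fun l => ?_⟩
    rw [tsum_fintype]
    have h1 := weight_pos (m + n) l
    have h2 : ∀ x : Finset.HasAntidiagonal.antidiagonal l,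
        ‖hankelEntry m n F x.1.1 x.1.2‖ ^ 2 * (weight m x.1.1)⁻¹ * weight n x.1.2 =
        ‖F.coeff l‖ ^ 2 * weight (m + n) l ^ 2 *
          ((weight m x.1.1)⁻¹ * (weight n x.1.2)⁻¹) := by
      intro x
      rw [h0, Finset.HasAntidiagonal.mem_antidiagonal.mp x.2]
    have h3 := Finset.sum_coe_sort (Finset.HasAntidiagonal.antidiagonal l)
      (fun p => (weight m p.1)⁻¹ * (weight n p.2)⁻¹)
    rw [sum_inv_weight] at h3
    simp only [Function.comp_apply, Finset.HasAntidiagonal.sigmaAntidiagonalEquivProd_apply]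
    rw [Finset.sum_congr rfl fun x _ => h2 x, ← Finset.mul_sum, h3]
    field_simp
  · intro x
    have := weight_pos m x.2.1.1
    have := weight_pos n x.2.1.2
    simp only [Function.comp_apply, Finset.HasAntidiagonal.sigmaAntidiagonalEquivProd_apply]
    positivity

theorem summable_hankel_row (F : HL2 (m + n)) (k : ℕ) :
    Summable fun j => ‖hankelEntry m n F j k‖ ^ 2 * (weight m j)⁻¹ := by
  have h := ((summable_hankelEntry m n F).prod_symm.prod_factor k).mul_right (weight n k)⁻¹
  refine h.congr fun j => ?_
  have := weight_pos n k
  simp only [Prod.swap_prod_mk]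
  field_simp

theorem hankel_row_le (F : HL2 (m + n)) (f : HL2 m) (k : ℕ) :
    (Summable fun j => hankelEntry m n F j k * f.coeff j) ∧
    ‖∑' j, hankelEntry m n F j k * f.coeff j‖ ^ 2 ≤
      (∑' j, ‖hankelEntry m n F j k‖ ^ 2 * (weight m j)⁻¹) * ‖f‖ ^ 2 := by
  have hw := fun j => weight_pos m j
  have e1 : ∀ j, (‖hankelEntry m n F j k‖ * (Real.sqrt (weight m j))⁻¹) ^ (2 : ℝ) =
      ‖hankelEntry m n F j k‖ ^ 2 * (weight m j)⁻¹ := fun j => by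
    rw [Real.rpow_two, mul_pow, inv_pow, Real.sq_sqrt (hw j).le]
  have e2 : ∀ j, (‖f.coeff j‖ * Real.sqrt (weight m j)) ^ (2 : ℝ) =
      ‖f.coeff j‖ ^ 2 * weight m j := fun j => by
    rw [Real.rpow_two, mul_pow, Real.sq_sqrt (hw j).le]
  have e3 : ∀ j, ‖hankelEntry m n F j k‖ * (Real.sqrt (weight m j))⁻¹ *
      (‖f.coeff j‖ * Real.sqrt (weight m j)) = ‖hankelEntry m n F j k * f.coeff j‖ := fun j => by
    have := Real.sqrt_pos.mpr (hw j)
    rw [norm_mul]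
    field_simp
  have key := Real.summable_and_inner_le_Lp_mul_Lq_tsum_of_nonneg Real.HolderConjugate.two_two
    (f := fun j => ‖hankelEntry m n F j k‖ * (Real.sqrt (weight m j))⁻¹)
    (g := fun j => ‖f.coeff j‖ * Real.sqrt (weight m j))
    (fun j => by positivity) (fun j => by positivity)
    ((summable_hankel_row m n F k).congr fun j => (e1 j).symm)
    (f.summable.congr fun j => (e2 j).symm)
  simp only [e1, e2, e3, ← HL2.norm_sq_eq] at key
  refine ⟨key.1.of_norm, ?_⟩
  have hR : 0 ≤ ∑' j, ‖hankelEntry m n F j k‖ ^ 2 * (weight m j)⁻¹ :=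
    tsum_nonneg fun j => mul_nonneg (by positivity) (inv_nonneg.mpr (hw j).le)
  have h2 := (norm_tsum_le_tsum_norm key.1).trans key.2
  calc _ ≤ _ := pow_le_pow_left₀ (norm_nonneg _) h2 2
    _ = _ := by
      rw [mul_pow, ← Real.sqrt_eq_rpow, ← Real.sqrt_eq_rpow, Real.sq_sqrt hR,
        Real.sq_sqrt (by positivity)]

theorem summable_hankel_rows (F : HL2 (m + n)) :
    Summable fun k => (∑' j, ‖hankelEntry m n F j k‖ ^ 2 * (weight m j)⁻¹) * weight n k := by
  refine (summable_hankelEntry m n F).prod_symm.prod.congr fun k => ?_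
  simp only [Prod.swap_prod_mk]
  rw [tsum_mul_right]

theorem summable_hankel_apply (F : HL2 (m + n)) (f : HL2 m) :
    Summable fun k => ‖∑' j, hankelEntry m n F j k * f.coeff j‖ ^ 2 * weight n k := by
  refine ((summable_hankel_rows m n F).mul_left (‖f‖ ^ 2)).of_nonneg_of_le (fun k => ?_)
    fun k => ?_
  · have := weight_pos n k
    positivity
  · have h1 := weight_pos n k
    have h2 := (hankel_row_le m n F f k).2
    nlinarith [mul_le_mul_of_nonneg_right h2 h1.le]

/-- The generalized Hankel operator `B(m, n; F)`: it maps `∑ f_j z^j (dz)^m` to `∑ h_k z^k (dz)^n`,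
where `h_k = ∑_j F_{k+j} B(k+j+1, 2m+2n) / B(k+1, 2n) f_j`.  The domain is the conjugate space of
`H^m ∩ L²`, identified with `H^m ∩ L²` through `conj f ↔ ∑ conj(f_j) z^j (dz)^m`; with this
identification `⟨F, f g⟩ = ⟨B(m, n; F) (conj f), g⟩`. -/
def hankelOp (F : HL2 (m + n)) : HL2 m →L[ℂ] HL2 n :=
  LinearMap.mkContinuous
    { toFun := fun f => HL2.ofCoeff n (fun k => ∑' j, hankelEntry m n F j k * f.coeff j)
        (summable_hankel_apply m n F f)
      map_add' := fun f g => HL2.ext_coeff fun k => by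
        simp only [HL2.coeff_add, HL2.coeff_ofCoeff, mul_add]
        exact (hankel_row_le m n F f k).1.tsum_add (hankel_row_le m n F g k).1
      map_smul' := fun c f => HL2.ext_coeff fun k => by
        simp only [HL2.coeff_smul, HL2.coeff_ofCoeff, RingHom.id_apply, ← tsum_mul_left]
        exact tsum_congr fun j => by ring }
    (Real.sqrt (∑' k, (∑' j, ‖hankelEntry m n F j k‖ ^ 2 * (weight m j)⁻¹) * weight n k))
    fun f => by
      have hT : 0 ≤ ∑' k, (∑' j, ‖hankelEntry m n F j k‖ ^ 2 * (weight m j)⁻¹) * weight n k :=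
        tsum_nonneg fun k => mul_nonneg (tsum_nonneg fun j => mul_nonneg (by positivity)
          (inv_nonneg.mpr (weight_pos m j).le)) (weight_pos n k).le
      rw [← pow_le_pow_iff_left₀ (norm_nonneg _) (by positivity) two_ne_zero, mul_pow,
        Real.sq_sqrt hT, HL2.norm_sq_eq, ← tsum_mul_right]
      simp only [LinearMap.coe_mk, AddHom.coe_mk, HL2.coeff_ofCoeff]
      refine (summable_hankel_apply m n F f).tsum_le_tsum (fun k => ?_)
        ((summable_hankel_rows m n F).mul_right (‖f‖ ^ 2))
      nlinarith [mul_le_mul_of_nonneg_right (hankel_row_le m n F f k).2 (weight_pos n k).le]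

theorem coeff_hankelOp (F : HL2 (m + n)) (f : HL2 m) (k : ℕ) :
    (hankelOp m n F f).coeff k = ∑' j, hankelEntry m n F j k * f.coeff j :=
  HL2.coeff_ofCoeff _ (summable_hankel_apply m n F f) k

end Hankel

/-! ### The Fredholm determinant -/

section Fredholm

variable {ι E : Type*} [DecidableEq ι] [NormedAddCommGroup E] [InnerProductSpace ℂ E]

/-- The principal minor of `A` on the finite set `s` of vectors of an orthonormal basis. -/
def principalMinor (b : HilbertBasis ι ℂ E) (A : E →L[ℂ] E) (s : Finset ι) : ℂ :=
  (Matrix.of fun i j : s => inner ℂ (b i) (A (b j))).det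

/-- The Fredholm determinant `det(1 + A) = ∑_k tr(Λ^k A)` of a trace class operator `A`; here
`tr(Λ^k A)` is computed in an orthonormal basis, as the sum of the principal minors of size `k`
of the matrix of `A`. -/
def fredholmDet (b : HilbertBasis ι ℂ E) (A : E →L[ℂ] E) : ℂ :=
  ∑' s : Finset ι, principalMinor b A s

end Fredholm

/-! ### Gaussian measures, multiplicative image, Fourier transform -/

/-- The law on `ℂ` of `X + iY`, with `X`, `Y` independent real Gaussian variables of mean `0` and
variance `v`.  If `v > 0`, its density is `(2πv)⁻¹ exp(-|z|² / (2v))`. -/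
def complexGaussian (v : ℝ≥0) : Measure ℂ :=
  ((gaussianReal 0 v).prod (gaussianReal 0 v)).map fun p => (p.1 : ℂ) + (p.2 : ℂ) * Complex.I

instance (v : ℝ≥0) : IsProbabilityMeasure (complexGaussian v) :=
  Measure.isProbabilityMeasure_map (by fun_prop)

/-- The Gaussian measure `ν_T^{(m)}` on `H^m`: the law of the random series `(∑ f_k z^k)(dz)^m`,
where the `f_k` are independent complex Gaussian variables with densities
`B(k+1, 2m) / (2πT) exp(-B(k+1, 2m) |f_k|² / (2T))`. -/
def gaussian (m T : ℝ) : Measure (HDiff m) :=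
  (Measure.infinitePi fun k => complexGaussian (T / weight m k).toNNReal).map (taylorSeries m)

/-- The multiplicative image `ν ⊗ μ = M_*(ν × μ)`, where `M` is the multiplication
`H^m × H^n → H^(m+n)`. -/
def mulImage {m n : ℝ} (ν : Measure (HDiff m)) (μ : Measure (HDiff n)) :
    Measure (HDiff (m + n)) :=
  (ν.prod μ).map (mulDiff m n)

section Fourier

variable {m : ℝ} [Fact (0 < m)]

/-- The pairing `⟨F_{<N}, f⟩ = ∑_{k<N} F_k conj(f_k) B(k+1, 2m)`, where `F_{<N}` is the Taylor
polynomial `∑_{k<N} F_k z^k`.  It is defined for all `f ∈ H^m`. -/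
def partialPairing (F : HL2 m) (N : ℕ) (f : HDiff m) : ℂ :=
  ∑ k ∈ Finset.range N, F.coeff k * conj (coeff f k) * (weight m k : ℂ)

/-- `φ` is the Fourier transform of the measure `ν` on `H^m`, as a function on `H^m ∩ L²`.

For a polynomial `F`, the Fourier transform is `∫ exp(-i Re ⟨F, f⟩) dν(f)`; on all of
`H^m ∩ L²` it is the continuous extension, and it is given by the same integral if the pairing
`⟨F, ·⟩` is understood as the limit in `ν`-measure of the pairings with the Taylor polynomials
of `F`. -/
structure IsFourierTransform (ν : Measure (HDiff m)) (φ : HL2 m → ℂ) : Prop where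
  eq_integral_of_polynomial : ∀ (F : HL2 m) (N : ℕ), (∀ k, N ≤ k → F.coeff k = 0) →
    φ F = ∫ f, Complex.exp (-Complex.I * ((partialPairing F N f).re : ℂ)) ∂ν
  continuous : Continuous φ
  eq_integral : ∀ F : HL2 m, ∃ X : HDiff m → ℂ,
    AEStronglyMeasurable X ν ∧ TendstoInMeasure ν (partialPairing F) atTop X ∧
    φ F = ∫ f, Complex.exp (-Complex.I * ((X f).re : ℂ)) ∂ν

end Fourier

end Disk

end

/-! ### Moments and characteristic functions of complex Gaussian vectors -/

namespace Disk

/-! Write `f_j = √(S/B(j+1,2m)) x_j` and `g_k = √(T/B(k+1,2n)) y_k` with independent standard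
complex Gaussians `x_j`, `y_k`. By the Cauchy product, `⟨F, fg⟩` is `√(ST) ∑ β_{kj} conj(y_k)
conj(x_j)`, where `β` is the matrix of `B(m,n;F)` in the orthonormal bases
(`ae_partialPairing_productSeries`).

For polynomial `F` only finitely many entries matter. Integrating over `x` with `y` fixed gives
`exp(-ST y*ββ*y/2)`. Diagonalising `ββ*` by a unitary matrix, which preserves the law of `y`, turns
the remaining integral into the product of the `(1 + STλ)⁻¹` over its eigenvalues, which is `1/det(1
+ STββ*)` (`integral_cexp_bilinear`).

Two estimates carry this to all `F`. On the probabilistic side, the Chu-Vandermonde identity says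
that the Hilbert–Schmidt norm of `B(m,n;F)` is the norm of `F`. The pairing with a Taylor polynomial
of `F` therefore has second moment `4ST` times the squared norm of that polynomial
(`lintegral_enorm_sq_partialPairing`), so these pairings converge in `L²`, and the transform is
Lipschitz in `F`. On the determinant side, the principal minors are Gram determinants of the vectors
`√(ST) B* e_k`. Hadamard's inequality bounds them by products of the terms `ST|B* e_k|²` of a
convergent series, and these bounds only decrease when `F` is truncated. Dominated convergence then
gives convergence of the determinants (`tendsto_hankelDet_truncate`). Their limit is nonzero because
the reciprocals are integrals of unimodular functions, hence at most `1` in modulus. -/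

@[fun_prop]
theorem measurable_starRingEnd : Measurable (starRingEnd ℂ) :=
  Complex.continuous_conj.measurable

open Complex in
theorem charFun_complexGaussian (v : ℝ≥0) (t : ℂ) :
    charFun (complexGaussian v) t = cexp (-(v * ‖t‖ ^ 2 / 2 : ℝ)) := by
  have h1 : ∀ p : ℝ × ℝ, cexp ((inner ℝ ((p.1 : ℂ) + p.2 * I) t : ℝ) * I) =
      cexp (t.re * p.1 * I) * cexp (t.im * p.2 * I) := fun p => by
    rw [← Complex.exp_add, ← add_mul]
    congr 2
    rw [Complex.inner]
    simp
  rw [charFun_apply, complexGaussian, integral_map (by fun_prop) (by fun_prop)]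
  simp_rw [h1]
  rw [integral_prod_mul (fun x : ℝ => cexp (t.re * x * I)) (fun x : ℝ => cexp (t.im * x * I)),
    ← charFun_apply_real, ← charFun_apply_real, charFun_gaussianReal, charFun_gaussianReal,
    ← Complex.exp_add, ← Complex.normSq_eq_norm_sq, Complex.normSq_apply]
  congr 1
  push_cast
  ring

/-- Scaling of a complex Gaussian variable. -/
theorem complexGaussian_map_mul (v : ℝ≥0) (c : ℂ) :
    (complexGaussian v).map (fun z => c * z) = complexGaussian (‖c‖₊ ^ 2 * v) := by
  have : IsProbabilityMeasure ((complexGaussian v).map (fun z => c * z)) :=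
    Measure.isProbabilityMeasure_map (by fun_prop)
  refine Measure.ext_of_charFun (funext fun t => ?_)
  have h : ∀ z : ℂ, inner ℝ (c * z) t = inner ℝ z (conj c * t) := fun z => by
    simp only [Complex.inner]
    simp
    ring
  rw [charFun_apply, integral_map (by fun_prop) (by fun_prop)]
  simp_rw [h]
  rw [← charFun_apply, charFun_complexGaussian, charFun_complexGaussian, norm_mul,
    RCLike.norm_conj]
  congr 2
  push_cast
  ring

open Complex in
-- Each `Re(d_k conj(x_k))` is the real inner product of `x_k` and `d_k`, so the integrand splits
-- into coordinates and every factor is a characteristic function.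
theorem integral_cexp_sum {ι : Type*} [Fintype ι] (d : ι → ℂ) :
    ∫ x : ι → ℂ, cexp (I * ((∑ k, d k * conj (x k)).re : ℂ))
      ∂(Measure.pi fun _ => complexGaussian 1) = cexp (-(∑ k, ‖d k‖ ^ 2 : ℝ) / 2) := by
  have h : ∀ x : ι → ℂ, cexp (I * ((∑ k, d k * conj (x k)).re : ℂ)) =
      ∏ k, cexp ((inner ℝ (x k) (d k) : ℝ) * I) := fun x => by
    rw [← Complex.exp_sum, ← Finset.sum_mul, mul_comm, ← Complex.ofReal_sum, Complex.re_sum]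
    rfl
  simp_rw [h]
  rw [integral_fintype_prod_eq_prod (fun k z => cexp ((inner ℝ z (d k) : ℝ) * I))]
  simp_rw [← charFun_apply, charFun_complexGaussian, ← Complex.exp_sum]
  congr 1
  push_cast
  rw [← Finset.sum_neg_distrib, Finset.sum_div]
  exact Finset.sum_congr rfl fun k _ => by ring

/-- A linear combination of independent standard complex Gaussian variables is Gaussian. -/
theorem map_sum_mul_conj {ι : Type*} [Fintype ι] (d : ι → ℂ) :
    (Measure.pi fun _ : ι => complexGaussian 1).map (fun x => ∑ k, d k * conj (x k)) =
      complexGaussian (∑ k, ‖d k‖₊ ^ 2) := by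
  have hm : Measurable fun x : ι → ℂ => ∑ k, d k * conj (x k) := by fun_prop
  have : IsProbabilityMeasure ((Measure.pi fun _ : ι => complexGaussian 1).map
      (fun x => ∑ k, d k * conj (x k))) :=
    Measure.isProbabilityMeasure_map hm.aemeasurable
  refine Measure.ext_of_charFun (funext fun t => ?_)
  have h : ∀ x : ι → ℂ, ((inner ℝ (∑ k, d k * conj (x k)) t : ℝ) : ℂ) * Complex.I =
      Complex.I * ((∑ k, (conj t * d k) * conj (x k)).re : ℂ) := fun x => by
    rw [mul_comm]
    congr 2
    simp_rw [mul_assoc, ← Finset.mul_sum]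
    rw [real_inner_comm, Complex.inner, mul_comm (conj t)]
  rw [charFun_apply, integral_map hm.aemeasurable (by fun_prop)]
  simp_rw [h]
  rw [integral_cexp_sum, charFun_complexGaussian]
  congr 1
  simp_rw [norm_mul, RCLike.norm_conj, mul_pow, ← Finset.mul_sum]
  push_cast
  ring

theorem lintegral_enorm_sq_complexGaussian (v : ℝ≥0) :
    ∫⁻ z, ‖z‖ₑ ^ 2 ∂(complexGaussian v) = 2 * v := by
  have h : ∀ p : ℝ × ℝ, ‖(p.1 : ℂ) + p.2 * Complex.I‖ₑ ^ 2 =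
      ENNReal.ofReal (p.1 ^ 2) + ENNReal.ofReal (p.2 ^ 2) := fun p => by
    rw [← ENNReal.ofReal_add (by positivity) (by positivity), ← ofReal_norm,
      ← ENNReal.ofReal_pow (norm_nonneg _), ← Complex.normSq_eq_norm_sq,
      Complex.normSq_add_mul_I]
  have h2 : ∫⁻ x : ℝ, ENNReal.ofReal (x ^ 2) ∂(gaussianReal 0 v) = v := by
    have hv := variance_id_gaussianReal (μ := 0) (v := v)
    have := IsGaussian.memLp_two_id (μ := gaussianReal 0 v)
    rw [variance_of_integral_eq_zero (by fun_prop) (by simp)] at hv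
    have h3 := ofReal_integral_eq_lintegral_ofReal this.integrable_sq
      (ae_of_all _ fun x => sq_nonneg _)
    rw [hv] at h3
    simpa using h3.symm
  rw [complexGaussian, lintegral_map (by fun_prop) (by fun_prop)]
  simp_rw [h]
  rw [lintegral_add_left (by fun_prop), lintegral_prod _ (by fun_prop),
    lintegral_prod _ (by fun_prop)]
  simp [h2, two_mul]

theorem lintegral_enorm_sq_sum {ι : Type*} [Fintype ι] (d : ι → ℂ) :
    ∫⁻ x : ι → ℂ, ‖∑ k, d k * conj (x k)‖ₑ ^ 2 ∂(Measure.pi fun _ => complexGaussian 1) =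
      2 * ∑ k, ‖d k‖ₑ ^ 2 := by
  rw [← lintegral_map (f := fun z : ℂ => ‖z‖ₑ ^ 2) (by fun_prop) (by fun_prop),
    map_sum_mul_conj, lintegral_enorm_sq_complexGaussian]
  push_cast
  rfl

/-- For fixed `y` the form is linear in `x`, and its coefficients are in turn linear in `y`. Each of
the two integrations contributes a factor `2`, the second moment of a standard complex Gaussian. -/
theorem lintegral_enorm_sq_bilinear {ι κ : Type*} [Fintype ι] [Fintype κ]
    (β : Matrix κ ι ℂ) :
    ∫⁻ y : κ → ℂ, ∫⁻ x : ι → ℂ, ‖∑ j, (∑ k, β k j * conj (y k)) * conj (x j)‖ₑ ^ 2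
      ∂(Measure.pi fun _ => complexGaussian 1) ∂(Measure.pi fun _ => complexGaussian 1) =
      4 * ∑ j, ∑ k, ‖β k j‖ₑ ^ 2 := by
  simp_rw [lintegral_enorm_sq_sum]
  rw [lintegral_const_mul _ (by fun_prop), lintegral_finsetSum _ (by fun_prop)]
  simp_rw [lintegral_enorm_sq_sum, ← Finset.mul_sum, ← mul_assoc]
  norm_num

end Disk

/-! ### Gaussian integrals of Hermitian and bilinear forms -/

namespace Disk

open Matrix
open scoped ComplexOrder

/-- The characteristic function of the standard Gaussian vector depends only on `|t|`. Applying `U`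
to the vector replaces `t` by `Uᴴt`, which has the same norm. -/
theorem map_mulVec_complexGaussian {ι : Type*} [Fintype ι] [DecidableEq ι] (U : Matrix ι ι ℂ)
    (hU : U * Uᴴ = 1) :
    (Measure.pi fun _ : ι => complexGaussian 1).map (U *ᵥ ·) =
      Measure.pi fun _ : ι => complexGaussian 1 := by
  have hm : Measurable fun x : ι → ℂ => U *ᵥ x :=
    (Continuous.matrix_mulVec continuous_const continuous_id).measurable
  have : IsProbabilityMeasure ((Measure.pi fun _ : ι => complexGaussian 1).map (U *ᵥ ·)) :=
    Measure.isProbabilityMeasure_map hm.aemeasurable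
  refine (charFun_eq_pi_iff (μ := fun _ => complexGaussian 1)).mp fun t => ?_
  have h : ∀ x : ι → ℂ, inner ℝ (WithLp.toLp 2 (U *ᵥ x) : PiLp 2 fun _ : ι => ℂ) t =
      (∑ j, (Uᴴ *ᵥ t) j * conj (x j)).re := fun x => by
    have e : ∑ j, (Uᴴ *ᵥ t) j * conj (x j) = ∑ k, t k * conj ((U *ᵥ x) k) := by
      simp only [mulVec, dotProduct, map_sum, map_mul, Finset.mul_sum, Finset.sum_mul]
      rw [Finset.sum_comm]
      refine Finset.sum_congr rfl fun k _ => Finset.sum_congr rfl fun j _ => ?_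
      simp only [conjTranspose_apply, RCLike.star_def]
      ring
    rw [e, PiLp.inner_apply, Complex.re_sum]
    rfl
  have hn : ∑ k, ‖(Uᴴ *ᵥ t) k‖ ^ 2 = ∑ k, ‖t k‖ ^ 2 := by
    have e : ∀ v : ι → ℂ, ((∑ k, ‖v k‖ ^ 2 : ℝ) : ℂ) = star v ⬝ᵥ v := fun v => by
      simp [dotProduct, ← Complex.conj_mul']
    rw [← Complex.ofReal_inj, e, e, star_mulVec, conjTranspose_conjTranspose,
      ← dotProduct_mulVec, mulVec_mulVec, hU, one_mulVec]
  rw [charFun_apply, integral_map (by fun_prop) (by fun_prop), integral_map (by fun_prop)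
    (by fun_prop)]
  simp_rw [h, mul_comm _ Complex.I]
  rw [integral_cexp_sum, hn]
  simp_rw [charFun_complexGaussian, ← Complex.exp_sum]
  congr 1
  push_cast
  rw [← Finset.sum_neg_distrib, Finset.sum_div]
  exact Finset.sum_congr rfl fun k _ => by ring

theorem integral_exp_neg_sq_gaussianReal (a : ℝ) (ha : 0 ≤ a) :
    ∫ x, Real.exp (-(a * x ^ 2 / 2)) ∂(gaussianReal 0 1) = (Real.sqrt (1 + a))⁻¹ := by
  rw [integral_gaussianReal_eq_integral_smul one_ne_zero]
  have h : ∀ x : ℝ, gaussianPDFReal 0 1 x • Real.exp (-(a * x ^ 2 / 2)) =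
      (Real.sqrt (2 * Real.pi))⁻¹ * Real.exp (-((1 + a) / 2) * x ^ 2) := fun x => by
    rw [gaussianPDFReal, smul_eq_mul, mul_assoc, ← Real.exp_add]
    simp only [NNReal.coe_one, mul_one, sub_zero]
    congr 2
    ring
  simp_rw [h]
  rw [integral_const_mul, integral_gaussian, show Real.pi / ((1 + a) / 2) =
    (2 * Real.pi) * (1 + a)⁻¹ by field_simp, Real.sqrt_mul (x := 2 * Real.pi) (by positivity),
    Real.sqrt_inv,
    ← mul_assoc, inv_mul_cancel₀ (by positivity), one_mul]

theorem integral_exp_neg_sq_complexGaussian (a : ℝ) (ha : 0 ≤ a) :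
    ∫ z, Real.exp (-(a * ‖z‖ ^ 2 / 2)) ∂(complexGaussian 1) = (1 + a)⁻¹ := by
  have h : ∀ p : ℝ × ℝ, Real.exp (-(a * ‖(p.1 : ℂ) + p.2 * Complex.I‖ ^ 2 / 2)) =
      Real.exp (-(a * p.1 ^ 2 / 2)) * Real.exp (-(a * p.2 ^ 2 / 2)) := fun p => by
    rw [← Real.exp_add, ← Complex.normSq_eq_norm_sq, Complex.normSq_add_mul_I]
    congr 1
    ring
  rw [complexGaussian, integral_map (by fun_prop) (by fun_prop)]
  simp_rw [h]
  rw [integral_prod_mul (fun x : ℝ => Real.exp (-(a * x ^ 2 / 2)))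
    (fun x : ℝ => Real.exp (-(a * x ^ 2 / 2))), integral_exp_neg_sq_gaussianReal a ha, ← mul_inv,
    Real.mul_self_sqrt (by positivity)]

/-- The Gaussian integral of a positive semidefinite Hermitian form. -/
theorem integral_exp_neg_posSemidef {ι : Type*} [Fintype ι] [DecidableEq ι] {H : Matrix ι ι ℂ}
    (hH : H.PosSemidef) :
    ∫ y : ι → ℂ, Complex.exp (-(star y ⬝ᵥ (H *ᵥ y)) / 2) ∂(Measure.pi fun _ => complexGaussian 1) =
      1 / (1 + H).det := by
  have hh := hH.isHermitian
  set U : Matrix ι ι ℂ := hh.eigenvectorUnitary.1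
  set l := hh.eigenvalues
  have hU : U * Uᴴ = 1 := Unitary.coe_mul_star_self hh.eigenvectorUnitary
  have hU' : Uᴴ * U = 1 := Unitary.coe_star_mul_self hh.eigenvectorUnitary
  have hspec : H = U * diagonal (fun i => (l i : ℂ)) * Uᴴ := hh.spectral_theorem
  have hdet : (1 + H).det = ∏ i, (1 + (l i : ℂ)) := by
    have : 1 + H = U * diagonal (fun i => 1 + (l i : ℂ)) * Uᴴ := by
      rw [← diagonal_add, diagonal_one, mul_add, add_mul, ← hspec, mul_one, hU]
    rw [this, det_mul_right_comm, hU, one_mul, det_diagonal]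
  have hm : Measurable fun x : ι → ℂ => U *ᵥ x :=
    (Continuous.matrix_mulVec continuous_const continuous_id).measurable
  have hf : Continuous fun y : ι → ℂ => Complex.exp (-(star y ⬝ᵥ (H *ᵥ y)) / 2) := by
    refine Complex.continuous_exp.comp (Continuous.div_const (Continuous.neg ?_) _)
    exact Continuous.dotProduct continuous_star
      (Continuous.matrix_mulVec continuous_const continuous_id)
  have h : ∀ x : ι → ℂ, Complex.exp (-(star (U *ᵥ x) ⬝ᵥ (H *ᵥ (U *ᵥ x))) / 2) =
      ∏ i, (Real.exp (-(l i * ‖x i‖ ^ 2 / 2)) : ℂ) := fun x => by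
    have e : Uᴴ * (H * U) = diagonal (fun i => (l i : ℂ)) := by
      rw [hspec, mul_assoc, hU', mul_one, ← mul_assoc, hU', one_mul]
    rw [star_mulVec, ← dotProduct_mulVec, mulVec_mulVec, mulVec_mulVec, Matrix.mul_assoc, e]
    simp_rw [Complex.ofReal_exp]
    rw [← Complex.exp_sum]
    congr 1
    simp only [dotProduct, mulVec_diagonal, Pi.star_apply, RCLike.star_def]
    rw [← Finset.sum_neg_distrib, Finset.sum_div]
    refine Finset.sum_congr rfl fun i _ => ?_
    push_cast
    rw [← Complex.conj_mul']
    ring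
  -- The substitution `y = Ux` preserves the measure and makes the form diagonal, so the integral
  -- factors over the eigenvalues.
  rw [← map_mulVec_complexGaussian U hU, integral_map hm.aemeasurable hf.aestronglyMeasurable]
  simp_rw [h]
  rw [integral_fintype_prod_eq_prod (fun i z => (Real.exp (-(l i * ‖z‖ ^ 2 / 2)) : ℂ)), hdet,
    one_div, ← Finset.prod_inv_distrib]
  refine Finset.prod_congr rfl fun i _ => ?_
  rw [integral_complex_ofReal, integral_exp_neg_sq_complexGaussian _ (hH.eigenvalues_nonneg i)]
  push_cast
  rfl

/-- The Fourier transform of a bilinear form in independent standard complex Gaussian vectors. -/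
theorem integral_cexp_bilinear {ι κ : Type*} [Fintype ι] [Fintype κ] [DecidableEq κ]
    (β : Matrix κ ι ℂ) :
    ∫ y : κ → ℂ, ∫ x : ι → ℂ, Complex.exp (-Complex.I *
        ((∑ j, (∑ k, β k j * conj (y k)) * conj (x j)).re : ℂ))
      ∂(Measure.pi fun _ => complexGaussian 1) ∂(Measure.pi fun _ => complexGaussian 1) =
      1 / (1 + β * βᴴ).det := by
  rw [← integral_exp_neg_posSemidef (posSemidef_self_mul_conjTranspose β)]
  congr 1
  ext y
  have h : ∀ x : ι → ℂ, -Complex.I * ((∑ j, (∑ k, β k j * conj (y k)) * conj (x j)).re : ℂ) =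
      Complex.I * ((∑ j, (-∑ k, β k j * conj (y k)) * conj (x j)).re : ℂ) := fun x => by
    simp
  simp_rw [h]
  -- The inner integral leaves `∑_j |∑_k β_{kj} conj(y_k)|²` in the exponent, which is the quadratic
  -- form of `ββᴴ` at `y`.
  rw [integral_cexp_sum, ← mulVec_mulVec, dotProduct_mulVec]
  congr 3
  simp only [dotProduct, vecMul, mulVec, norm_neg, Complex.ofReal_sum]
  refine Finset.sum_congr rfl fun j _ => ?_
  rw [Complex.ofReal_pow, ← Complex.mul_conj', map_sum]
  congr 1 <;> exact Finset.sum_congr rfl fun k _ => by simp [mul_comm]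

end Disk

namespace Disk

open Matrix
open scoped ComplexOrder

/-! ### Determinants -/

/-- The expansion of `det (1 + M)` into principal minors. -/
theorem det_one_add_eq_sum_minors {ι R : Type*} [Fintype ι] [DecidableEq ι] [CommRing R]
    (M : Matrix ι ι R) :
    (1 + M).det = ∑ s : Finset ι, (M.submatrix (Subtype.val : s → ι) Subtype.val).det := by
  rw [add_comm]
  -- By multilinearity in the rows, `s` records which rows are taken from `M`; the others come from
  -- the identity.
  refine (detRowAlternating.map_add_univ M (1 : Matrix ι ι R)).trans ?_
  exact Finset.sum_congr rfl fun s _ => det_piecewise_one_eq_submatrix_det M s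

/-- Hadamard's inequality for Gram determinants of unit vectors. -/
theorem norm_det_gram_le_one {ι E : Type*} [Fintype ι] [DecidableEq ι] [NormedAddCommGroup E]
    [InnerProductSpace ℂ E] (v : ι → E) (hv : ∀ i, ‖v i‖ = 1) : ‖(gram ℂ v).det‖ ≤ 1 := by
  have hp := posSemidef_gram ℂ v
  have hh := hp.isHermitian
  have ht : ∑ i, hh.eigenvalues i = Fintype.card ι := by
    have h := hh.trace_eq_sum_eigenvalues
    have h2 : (gram ℂ v).trace = (Fintype.card ι : ℂ) := by
      simp [trace, gram_apply, inner_self_eq_norm_sq_to_K, hv]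
    rw [h2] at h
    have h3 : ((∑ i, hh.eigenvalues i : ℝ) : ℂ) = ((Fintype.card ι : ℝ) : ℂ) := by
      push_cast
      exact h.symm
    exact Complex.ofReal_injective h3
  rw [hh.det_eq_prod_eigenvalues, norm_prod]
  -- The bound `λ ≤ exp(λ - 1)` plays the role of the inequality of the means: the exponents add up
  -- to the trace minus the size, which is `0` for unit vectors.
  calc ∏ i, ‖((hh.eigenvalues i : ℝ) : ℂ)‖ ≤ ∏ i, Real.exp (hh.eigenvalues i - 1) := by
        refine Finset.prod_le_prod (fun i _ => norm_nonneg _) fun i _ => ?_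
        rw [Complex.norm_real, Real.norm_of_nonneg (hp.eigenvalues_nonneg i)]
        linarith [Real.add_one_le_exp (hh.eigenvalues i - 1)]
    _ = 1 := by simp [← Real.exp_sum, ht]

/-- Hadamard's inequality for Gram determinants. -/
theorem norm_det_gram_le {ι E : Type*} [Fintype ι] [DecidableEq ι] [NormedAddCommGroup E]
    [InnerProductSpace ℂ E] (v : ι → E) : ‖(gram ℂ v).det‖ ≤ ∏ i, ‖v i‖ ^ 2 := by
  by_cases h : ∃ i, v i = 0
  · obtain ⟨i, hi⟩ := h
    rw [det_eq_zero_of_row_eq_zero i fun j => by simp [gram_apply, hi], norm_zero]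
    positivity
  push Not at h
  have hn : ∀ i, (‖v i‖ : ℂ) ≠ 0 := fun i => by simpa using h i
  have hu : ∀ i, ‖(‖v i‖ : ℂ)⁻¹ • v i‖ = 1 := fun i => by
    rw [norm_smul, norm_inv, Complex.norm_real, norm_norm, inv_mul_cancel₀ (by simpa using h i)]
  have e : gram ℂ v = diagonal (fun i => (‖v i‖ : ℂ)) *
      gram ℂ (fun i => (‖v i‖ : ℂ)⁻¹ • v i) * diagonal (fun i => (‖v i‖ : ℂ)) := by
    ext i j
    have h1 := hn i
    have h2 := hn j
    simp only [mul_diagonal, diagonal_mul, gram_apply, inner_smul_left, inner_smul_right, map_inv₀,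
      Complex.conj_ofReal]
    field_simp
  rw [e, det_mul, det_mul, det_diagonal, norm_mul, norm_mul, norm_prod]
  simp_rw [Complex.norm_real, norm_norm]
  rw [Finset.prod_pow, sq]
  have := norm_det_gram_le_one _ hu
  have h0 : 0 ≤ ∏ i, ‖v i‖ := by positivity
  nlinarith [mul_le_mul_of_nonneg_left this (mul_nonneg h0 h0)]

/-! ### The matrix of the Hankel operator in the orthonormal bases -/

theorem inner_basis {m : ℝ} [Fact (0 < m)] (f : HL2 m) (k : ℕ) :
    inner ℂ (HL2.basis m k) f = (Real.sqrt (weight m k) : ℂ) * f.coeff k :=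
  ((HL2.basis m).repr_apply_apply f k).symm

theorem coeff_basis (m : ℝ) [Fact (0 < m)] (j k : ℕ) :
    (HL2.basis m j).coeff k = if k = j then (Real.sqrt (weight m k) : ℂ)⁻¹ else 0 := by
  have h := inner_basis (HL2.basis m j) k
  rw [orthonormal_iff_ite.mp (HL2.basis m).orthonormal] at h
  have h0 := HL2.sqrt_weight_ne (m := m) k
  rw [← mul_right_inj' h0, ← h]
  split_ifs <;> simp [h0]

theorem hasSum_norm_inner_basis {m : ℝ} [Fact (0 < m)] (f : HL2 m) :
    HasSum (fun k => ‖inner ℂ (HL2.basis m k) f‖ ^ 2) (‖f‖ ^ 2) := by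
  simp_rw [inner_basis, HL2.norm_sqrt_weight_mul, HL2.norm_sq_eq]
  exact f.summable.hasSum

section HankelMatrix

variable (m n : ℝ) [Fact (0 < m)] [Fact (0 < n)]

/-- The matrix of the Hankel operator in the orthonormal bases. -/
noncomputable def hankelMatrix (F : HL2 (m + n)) : Matrix ℕ ℕ ℂ := Matrix.of fun k j =>
  F.coeff (k + j) *
    ((weight (m + n) (k + j) / (Real.sqrt (weight n k) * Real.sqrt (weight m j)) : ℝ) : ℂ)

variable {m n}

theorem norm_hankelMatrix_sq (F : HL2 (m + n)) (k j : ℕ) :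
    ‖hankelMatrix m n F k j‖ ^ 2 =
      ‖hankelEntry m n F j k‖ ^ 2 * (weight m j)⁻¹ * weight n k := by
  have h1 := weight_pos n k
  have h2 := weight_pos m j
  simp only [hankelMatrix, of_apply, hankelEntry, norm_mul, Complex.norm_real, mul_pow,
    Real.norm_eq_abs, sq_abs, div_pow, Real.sq_sqrt h1.le, Real.sq_sqrt h2.le]
  field_simp

theorem inner_hankelOp_basis (F : HL2 (m + n)) (k j : ℕ) :
    inner ℂ (HL2.basis n k) (hankelOp m n F (HL2.basis m j)) = hankelMatrix m n F k j := by
  have h1 := Real.sqrt_pos.mpr (weight_pos n k)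
  have h2 := Real.sqrt_pos.mpr (weight_pos m j)
  have h3 := Real.sq_sqrt (weight_pos n k).le
  have h4 : (Real.sqrt (weight n k) : ℂ) ≠ 0 := by exact_mod_cast h1.ne'
  have h5 : (weight n k : ℂ) = (Real.sqrt (weight n k) : ℂ) * (Real.sqrt (weight n k) : ℂ) := by
    rw [← sq]
    exact_mod_cast h3.symm
  rw [inner_basis, coeff_hankelOp, tsum_eq_single j fun i hi => by simp [coeff_basis, hi],
    coeff_basis, if_pos rfl]
  simp only [hankelMatrix, of_apply, hankelEntry]
  push_cast
  rw [h5]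
  field_simp

theorem summable_hankelMatrix (F : HL2 (m + n)) :
    Summable fun p : ℕ × ℕ => ‖hankelMatrix m n F p.1 p.2‖ ^ 2 := by
  simp_rw [norm_hankelMatrix_sq]
  exact (summable_hankelEntry m n F).prod_symm

theorem summable_norm_hankelOp_basis (F : HL2 (m + n)) :
    Summable fun j => ‖hankelOp m n F (HL2.basis m j)‖ ^ 2 := by
  refine (summable_hankelMatrix F).prod_symm.prod.congr fun j => ?_
  simp_rw [← (hasSum_norm_inner_basis (hankelOp m n F (HL2.basis m j))).tsum_eq,
    inner_hankelOp_basis]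
  rfl

/-- Parseval: the coordinates of `B* e_k` are the conjugates of the entries of row `k`. -/
theorem hasSum_norm_adjoint_basis (F : HL2 (m + n)) (k : ℕ) :
    HasSum (fun j => ‖hankelMatrix m n F k j‖ ^ 2)
      (‖ContinuousLinearMap.adjoint (hankelOp m n F) (HL2.basis n k)‖ ^ 2) := by
  refine (hasSum_norm_inner_basis _).congr_fun fun j => ?_
  rw [ContinuousLinearMap.adjoint_inner_right, ← inner_conj_symm, inner_hankelOp_basis,
    RCLike.norm_conj]

theorem summable_norm_adjoint_basis (F : HL2 (m + n)) :
    Summable fun k => ‖ContinuousLinearMap.adjoint (hankelOp m n F) (HL2.basis n k)‖ ^ 2 :=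
  (summable_hankelMatrix F).prod.congr fun k => (hasSum_norm_adjoint_basis F k).tsum_eq

theorem inner_adjoint_basis (F : HL2 (m + n)) (k l : ℕ) :
    inner ℂ (ContinuousLinearMap.adjoint (hankelOp m n F) (HL2.basis n k))
      (ContinuousLinearMap.adjoint (hankelOp m n F) (HL2.basis n l)) =
      ∑' j, hankelMatrix m n F k j * conj (hankelMatrix m n F l j) := by
  rw [← (HL2.basis m).tsum_inner_mul_inner]
  refine tsum_congr fun j => ?_
  rw [ContinuousLinearMap.adjoint_inner_right, ContinuousLinearMap.adjoint_inner_left,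
    ← inner_conj_symm _ (HL2.basis n l), inner_hankelOp_basis, inner_hankelOp_basis]

/-! ### Principal minors and finite sections of the Fredholm determinant -/

/-- The entries of `cBB*` are `c⟨B* e_i, B* e_j⟩`. Giving `√c` to each side exhibits a Gram matrix,
to which Hadamard's inequality applies. -/
theorem principalMinor_eq_gram (F : HL2 (m + n)) (c : ℝ) (hc : 0 ≤ c) (s : Finset ℕ) :
    principalMinor (HL2.basis n) ((c : ℂ) • (hankelOp m n F ∘L
      ContinuousLinearMap.adjoint (hankelOp m n F))) s =
      (gram ℂ fun k : s => (Real.sqrt c : ℂ) •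
        ContinuousLinearMap.adjoint (hankelOp m n F) (HL2.basis n k)).det := by
  rw [principalMinor]
  congr 1
  ext i j
  have h : (c : ℂ) = (Real.sqrt c : ℂ) * (Real.sqrt c : ℂ) := by
    rw [← Complex.ofReal_mul, Real.mul_self_sqrt hc]
  simp only [of_apply, gram_apply, _root_.smul_apply, inner_smul_left,
    inner_smul_right, Complex.conj_ofReal, ContinuousLinearMap.adjoint_inner_left]
  rw [h, mul_assoc]
  rfl

theorem norm_principalMinor_le (F : HL2 (m + n)) (c : ℝ) (hc : 0 ≤ c) (s : Finset ℕ) :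
    ‖principalMinor (HL2.basis n) ((c : ℂ) • (hankelOp m n F ∘L
      ContinuousLinearMap.adjoint (hankelOp m n F))) s‖ ≤
      ∏ k ∈ s, c * ‖ContinuousLinearMap.adjoint (hankelOp m n F) (HL2.basis n k)‖ ^ 2 := by
  rw [principalMinor_eq_gram F c hc, ← Finset.prod_coe_sort s]
  refine (norm_det_gram_le _).trans (Finset.prod_le_prod (fun _ _ => by positivity) fun k _ => ?_)
  rw [norm_smul, Complex.norm_real, mul_pow, Real.norm_eq_abs, sq_abs, Real.sq_sqrt hc]

/-- The sum over finite sets is the expansion of `∏(1 + c|B* e_k|²)`, finite because `B*` is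
Hilbert–Schmidt. It also serves as the majorant for all truncations of `F`. -/
theorem summable_prod_norm_adjoint (F : HL2 (m + n)) (c : ℝ) (hc : 0 ≤ c) :
    Summable fun s : Finset ℕ =>
      ∏ k ∈ s, c * ‖ContinuousLinearMap.adjoint (hankelOp m n F) (HL2.basis n k)‖ ^ 2 :=
  summable_finsetProd_of_summable_nonneg (fun _ => by positivity)
    ((summable_norm_adjoint_basis F).mul_left c)

theorem summable_principalMinor (F : HL2 (m + n)) (c : ℝ) (hc : 0 ≤ c) :
    Summable (principalMinor (HL2.basis n) ((c : ℂ) • (hankelOp m n F ∘L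
      ContinuousLinearMap.adjoint (hankelOp m n F)))) :=
  (summable_prod_norm_adjoint F c hc).of_norm_bounded (norm_principalMinor_le F c hc)

/-- The Fredholm determinant `det(1 + c B(m,n;F) B(m,n;F)*)`. -/
noncomputable def hankelDet (c : ℝ) (F : HL2 (m + n)) : ℂ :=
  fredholmDet (HL2.basis n) ((c : ℂ) • (hankelOp m n F ∘L
      ContinuousLinearMap.adjoint (hankelOp m n F)))

/-- The finite sections of the matrix of the Hankel operator. -/
noncomputable def hankelSection (F : HL2 (m + n)) (N : ℕ) :
    Matrix (Finset.range N) (Finset.range N) ℂ :=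
  (hankelMatrix m n F).submatrix Subtype.val Subtype.val

theorem hankelMatrix_eq_zero {F : HL2 (m + n)} {N : ℕ} (hF : ∀ k, N ≤ k → F.coeff k = 0)
    {k j : ℕ} (h : N ≤ k ∨ N ≤ j) : hankelMatrix m n F k j = 0 := by
  rw [hankelMatrix, of_apply, hF _ (by omega), zero_mul]

/-- The matrix entries vanish once an index reaches `N`, so only minors on subsets of `range N`
survive, and these expand a finite determinant. -/
theorem hankelDet_of_polynomial {F : HL2 (m + n)} {N : ℕ} (hF : ∀ k, N ≤ k → F.coeff k = 0)
    (c : ℝ) (hc : 0 ≤ c) :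
    hankelDet c F = (1 + ((Real.sqrt c : ℂ) • hankelSection F N) *
      ((Real.sqrt c : ℂ) • hankelSection F N)ᴴ).det := by
  have hcc : (c : ℂ) = (Real.sqrt c : ℂ) * (Real.sqrt c : ℂ) := by
    rw [← Complex.ofReal_mul, Real.mul_self_sqrt hc]
  set M := ((Real.sqrt c : ℂ) • hankelSection F N) * ((Real.sqrt c : ℂ) • hankelSection F N)ᴴ
    with hM
  have hMe : ∀ i j : Finset.range N, M i j = (c : ℂ) *
      inner ℂ (ContinuousLinearMap.adjoint (hankelOp m n F) (HL2.basis n i))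
      (ContinuousLinearMap.adjoint (hankelOp m n F) (HL2.basis n j)) := fun i j => by
    rw [inner_adjoint_basis, tsum_eq_sum (s := Finset.range N) fun l hl => by
      rw [hankelMatrix_eq_zero hF (Or.inr (by simpa using hl)), zero_mul],
      ← Finset.sum_coe_sort, hM, mul_apply, Finset.mul_sum]
    refine Finset.sum_congr rfl fun l _ => ?_
    simp only [Matrix.smul_apply, conjTranspose_apply, hankelSection, submatrix_apply, smul_eq_mul,
      RCLike.star_def, map_mul, Complex.conj_ofReal, hcc]
    ring
  have hz : ∀ k, N ≤ k → ContinuousLinearMap.adjoint (hankelOp m n F) (HL2.basis n k) = 0 := by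
    intro k hk
    have h := hasSum_norm_adjoint_basis F k
    simp only [hankelMatrix_eq_zero hF (Or.inl hk)] at h
    simpa using h.unique (hasSum_zero.congr_fun fun j => by simp)
  -- A minor with an index `k ≥ N` vanishes by Hadamard's bound, since `B* e_k = 0`.
  have hs : ∀ s ∉ (Finset.range N).powerset, principalMinor (HL2.basis n)
      ((c : ℂ) • (hankelOp m n F ∘L ContinuousLinearMap.adjoint (hankelOp m n F))) s = 0 := by
    intro s hs
    rw [Finset.mem_powerset, Finset.not_subset] at hs
    obtain ⟨k, hk, hk'⟩ := hs
    refine norm_le_zero_iff.mp ((norm_principalMinor_le F c hc s).trans ?_)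
    rw [Finset.prod_eq_zero hk]
    rw [hz k (by simpa using hk')]
    simp
  rw [hankelDet, fredholmDet, tsum_eq_sum hs, det_one_add_eq_sum_minors]
  symm
  refine Finset.sum_bij (fun s _ => s.map (Function.Embedding.subtype _)) (fun s _ => ?_)
    (fun s _ t _ h => Finset.map_injective _ h) (fun t ht => ?_) fun s _ => ?_
  · rw [Finset.mem_powerset]
    exact Finset.map_subtype_subset s
  · refine ⟨t.subtype _, Finset.mem_univ _, Finset.subtype_map_of_mem fun x hx => ?_⟩
    exact Finset.mem_powerset.mp ht hx
  · rw [principalMinor, ← det_submatrix_equiv_self (s.equivMap (Function.Embedding.subtype _))]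
    congr 1
    ext i j
    simp only [submatrix_apply, hMe, of_apply, _root_.smul_apply, inner_smul_right,
      ContinuousLinearMap.adjoint_inner_left]
    rfl

/-! ### Truncation -/

theorem summable_truncate {m : ℝ} [Fact (0 < m)] (F : HL2 m) (N : ℕ) :
    Summable fun k => ‖if k < N then F.coeff k else 0‖ ^ 2 * weight m k :=
  summable_of_ne_finset_zero (s := Finset.range N) fun k hk => by
    rw [if_neg (by simpa using hk)]
    simp

/-- The Taylor polynomial of degree less than `N`. -/
noncomputable def truncate {m : ℝ} [Fact (0 < m)] (N : ℕ) (F : HL2 m) : HL2 m :=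
  HL2.ofCoeff m (fun k => if k < N then F.coeff k else 0) (summable_truncate F N)

theorem coeff_truncate {m : ℝ} [Fact (0 < m)] (N : ℕ) (F : HL2 m) (k : ℕ) :
    (truncate N F).coeff k = if k < N then F.coeff k else 0 :=
  HL2.coeff_ofCoeff _ (summable_truncate F N) k

theorem norm_hankelMatrix_truncate_le (F : HL2 (m + n)) (N k j : ℕ) :
    ‖hankelMatrix m n (truncate N F) k j‖ ≤ ‖hankelMatrix m n F k j‖ := by
  simp only [hankelMatrix, of_apply, coeff_truncate]
  split_ifs
  · rfl
  · rw [zero_mul, norm_zero]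
    exact norm_nonneg _

theorem tendsto_hankelMatrix_truncate (F : HL2 (m + n)) (k j : ℕ) :
    Tendsto (fun N => hankelMatrix m n (truncate N F) k j) atTop (𝓝 (hankelMatrix m n F k j)) := by
  refine tendsto_const_nhds.congr' ?_
  filter_upwards [eventually_gt_atTop (k + j)] with N hN
  simp only [hankelMatrix, of_apply, coeff_truncate, if_pos hN]

theorem tendsto_inner_adjoint_truncate (F : HL2 (m + n)) (k l : ℕ) :
    Tendsto (fun N =>
      inner ℂ (ContinuousLinearMap.adjoint (hankelOp m n (truncate N F)) (HL2.basis n k))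
        (ContinuousLinearMap.adjoint (hankelOp m n (truncate N F)) (HL2.basis n l))) atTop
      (𝓝 (inner ℂ (ContinuousLinearMap.adjoint (hankelOp m n F) (HL2.basis n k))
        (ContinuousLinearMap.adjoint (hankelOp m n F) (HL2.basis n l)))) := by
  simp_rw [inner_adjoint_basis]
  refine tendsto_tsum_of_dominated_convergence
    -- The product of the two entries is dominated through `ab ≤ a² + b²`; truncation only replaces
    -- entries by zero.
    (bound := fun j => ‖hankelMatrix m n F k j‖ ^ 2 + ‖hankelMatrix m n F l j‖ ^ 2)
    ((hasSum_norm_adjoint_basis F k).summable.add (hasSum_norm_adjoint_basis F l).summable)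
    (fun j => (tendsto_hankelMatrix_truncate F k j).mul
      ((Complex.continuous_conj.tendsto _).comp (tendsto_hankelMatrix_truncate F l j)))
    (Eventually.of_forall fun N j => ?_)
  rw [norm_mul, RCLike.norm_conj]
  have h1 := norm_hankelMatrix_truncate_le F N k j
  have h2 := norm_hankelMatrix_truncate_le F N l j
  nlinarith [mul_le_mul h1 h2 (norm_nonneg _) (norm_nonneg _),
    sq_nonneg (‖hankelMatrix m n F k j‖ - ‖hankelMatrix m n F l j‖),
    sq_nonneg ‖hankelMatrix m n F k j‖, sq_nonneg ‖hankelMatrix m n F l j‖]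

/-- Dominated convergence over the finite sets `s`: each minor is a polynomial in finitely many
convergent entries. Hadamard's bound for a truncation is at most the one for `F`, because truncation
does not increase `|B* e_k|`. -/
theorem tendsto_hankelDet_truncate (c : ℝ) (hc : 0 ≤ c) (F : HL2 (m + n)) :
    Tendsto (fun N => hankelDet c (truncate N F)) atTop (𝓝 (hankelDet c F)) := by
  refine tendsto_tsum_of_dominated_convergence (summable_prod_norm_adjoint F c hc) (fun s => ?_)
    (Eventually.of_forall fun N s => ?_)
  · simp only [principalMinor]
    refine (Continuous.matrix_det continuous_id).continuousAt.tendsto.comp ?_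
    refine tendsto_pi_nhds.mpr fun i => tendsto_pi_nhds.mpr fun j => ?_
    have h := (tendsto_inner_adjoint_truncate F i j).const_mul (c : ℂ)
    simp_rw [ContinuousLinearMap.adjoint_inner_left] at h
    simp only [of_apply, _root_.smul_apply, inner_smul_right]
    exact h
  · refine (norm_principalMinor_le _ c hc s).trans
      (Finset.prod_le_prod (fun _ _ => by positivity) fun k _ => ?_)
    refine mul_le_mul_of_nonneg_left ?_ hc
    refine hasSum_le (fun j => ?_) (hasSum_norm_adjoint_basis (truncate N F) k)
      (hasSum_norm_adjoint_basis F k)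
    exact pow_le_pow_left₀ (norm_nonneg _) (norm_hankelMatrix_truncate_le F N k j) 2

end HankelMatrix

end Disk

namespace Disk

/-! ### Topology and measurable structure of the space of differentials -/

instance : LocallyCompactSpace (Metric.ball (0 : ℂ) 1) :=
  Metric.isOpen_ball.locallyCompactSpace

instance (m : ℝ) : SecondCountableTopology (HDiff m) :=
  (Topology.IsInducing.subtypeVal
    (t := (holomorphic : Set C(Metric.ball (0 : ℂ) 1, ℂ)))).secondCountableTopology

instance (m : ℝ) : TopologicalSpace.PseudoMetrizableSpace (HDiff m) :=
  (Topology.IsInducing.subtypeVal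
    (t := (holomorphic : Set C(Metric.ball (0 : ℂ) 1, ℂ)))).pseudoMetrizableSpace

theorem taylorSeries_apply (m : ℝ) {a : ℕ → ℂ} (ha : Converges a) (z : Metric.ball (0 : ℂ) 1) :
    (taylorSeries m a).1 z = ∑' k, a k * (z : ℂ) ^ k := by
  rw [show taylorSeries m a = _ from dif_pos ha]
  rfl

theorem continuous_mulDiff (m n : ℝ) : Continuous (mulDiff m n) := by
  have h1 : Continuous fun p : HDiff m × HDiff n => p.1.1 :=
    continuous_subtype_val.comp continuous_fst
  have h2 : Continuous fun p : HDiff m × HDiff n => p.2.1 :=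
    continuous_subtype_val.comp continuous_snd
  exact Continuous.subtype_mk (h1.mul h2) _

theorem coeff_sub {m : ℝ} (f g : HDiff m) (k : ℕ) : coeff (f - g) k = coeff f k - coeff g k := by
  rw [eq_sub_iff_add_eq, ← coeff_add, sub_add_cancel]

/-- Cauchy's estimate on the circle of radius `1/2`; it is what makes the coefficients continuous
for locally uniform convergence. -/
theorem norm_coeff_le {m : ℝ} (f : HDiff m) (k : ℕ) {C : ℝ}
    (h : ∀ z : Metric.ball (0 : ℂ) 1, ‖(z : ℂ)‖ ≤ 1 / 2 → ‖f.1 z‖ ≤ C) :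
    ‖coeff f k‖ ≤ C * 2 ^ k := by
  have hs : ∀ z : ℂ, ‖z‖ ≤ 1 / 2 → z ∈ Metric.ball (0 : ℂ) 1 := fun z hz => by
    rw [mem_ball_zero_iff]
    linarith
  have hd : DiffContOnCl ℂ (ext f.1) (Metric.ball 0 (1 / 2)) := by
    refine DifferentiableOn.diffContOnCl (DifferentiableOn.mono f.2 fun z hz => hs z ?_)
    simpa using Metric.closure_ball_subset_closedBall hz
  have := Complex.norm_iteratedDeriv_le_of_forall_mem_sphere_norm_le k (by norm_num) hd (C := C)
    fun z hz => by
      have hz' : ‖z‖ ≤ 1 / 2 := (mem_sphere_zero_iff_norm.mp hz).le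
      rw [show ext f.1 z = f.1 ⟨z, hs z hz'⟩ from ext_apply f.1 ⟨z, hs z hz'⟩]
      exact h _ hz'
  rw [coeff, norm_mul, norm_inv, Complex.norm_natCast]
  have hk : (0 : ℝ) < k.factorial := by positivity
  rw [inv_mul_le_iff₀ hk]
  refine this.trans (le_of_eq ?_)
  rw [one_div, inv_pow, div_inv_eq_mul]
  ring

theorem continuous_coeff {m : ℝ} (k : ℕ) : Continuous fun f : HDiff m => coeff f k := by
  refine continuous_iff_continuousAt.mpr fun f => Metric.tendsto_nhds.mpr fun ε hε => ?_
  have hK : IsCompact {z : Metric.ball (0 : ℂ) 1 | ‖(z : ℂ)‖ ≤ 1 / 2} := by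
    refine Subtype.isCompact_iff.mpr ?_
    convert isCompact_closedBall (0 : ℂ) (1 / 2) using 1
    ext z
    simp only [Set.mem_image, Set.mem_ofPred_eq, Subtype.exists, mem_closedBall_zero_iff]
    constructor
    · rintro ⟨w, _, hw, rfl⟩
      exact hw
    · intro hz
      exact ⟨z, by rw [mem_ball_zero_iff]; linarith, hz, rfl⟩
  have h := ContinuousMap.tendsto_iff_forall_isCompact_tendstoUniformlyOn.mp
    (continuous_subtype_val.tendsto (X := holomorphic) f) _ hK
  -- The division by `2 ^ k` offsets Cauchy's estimate, and the extra half makes the final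
  -- inequality strict.
  have h2 := Metric.tendstoUniformlyOn_iff.mp h (ε / 2 / 2 ^ k) (by positivity)
  filter_upwards [h2] with g hg
  rw [dist_eq_norm, ← coeff_sub]
  refine (norm_coeff_le (g - f) k (C := ε / 2 / 2 ^ k) fun z hz => ?_).trans_lt ?_
  · have := hg z hz
    rw [dist_comm, dist_eq_norm] at this
    exact this.le
  · rw [div_mul_cancel₀ _ (by positivity)]
    linarith

theorem converges_coeff {m : ℝ} (f : HDiff m) : Converges (coeff f) := by
  intro r h0 h1
  have h := (hasSum_coeff f ⟨(r : ℂ), by simpa [abs_of_nonneg h0] using h1⟩).summable.norm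
  simpa [abs_of_nonneg h0] using h

/-- The Cauchy product of two absolutely convergent series sums to the product function, and the
coefficients of a convergent series are determined by its sum. -/
theorem coeff_mulDiff {m n : ℝ} (p : HDiff m × HDiff n) (l : ℕ) :
    coeff (mulDiff m n p) l =
      ∑ q ∈ Finset.HasAntidiagonal.antidiagonal l, coeff p.1 q.1 * coeff p.2 q.2 := by
  set a : ℕ → ℂ := fun l =>
    ∑ q ∈ Finset.HasAntidiagonal.antidiagonal l, coeff p.1 q.1 * coeff p.2 q.2
  have hterm : ∀ (z : ℂ) (l : ℕ), ∑ q ∈ Finset.HasAntidiagonal.antidiagonal l,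
      (coeff p.1 q.1 * z ^ q.1) * (coeff p.2 q.2 * z ^ q.2) = a l * z ^ l := fun z l => by
    rw [Finset.sum_mul]
    refine Finset.sum_congr rfl fun q hq => ?_
    rw [← Finset.HasAntidiagonal.mem_antidiagonal.mp hq, pow_add]
    ring
  have hs : ∀ {k : ℝ} (f : HDiff k) (z : ℂ), ‖z‖ < 1 → Summable fun k => ‖coeff f k * z ^ k‖ :=
    fun f z hz => by simpa using converges_coeff f ‖z‖ (norm_nonneg _) hz
  have ha : Converges a := by
    intro r h0 h1
    have hz : ‖(r : ℂ)‖ < 1 := by simpa [abs_of_nonneg h0] using h1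
    have := summable_norm_sum_mul_antidiagonal_of_summable_norm (hs p.1 r hz) (hs p.2 r hz)
    simp_rw [hterm] at this
    simpa [abs_of_nonneg h0] using this
  have he : taylorSeries (m + n) a = mulDiff m n p := by
    refine Subtype.ext (ContinuousMap.ext fun z => ?_)
    have hz : ‖(z : ℂ)‖ < 1 := mem_ball_zero_iff.mp z.2
    rw [taylorSeries_apply _ ha, show (mulDiff m n p).1 z = p.1.1 z * p.2.1 z from rfl,
      ← (hasSum_coeff p.1 z).tsum_eq, ← (hasSum_coeff p.2 z).tsum_eq,
      tsum_mul_tsum_eq_tsum_sum_antidiagonal_of_summable_norm (hs _ _ hz) (hs _ _ hz)]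
    simp_rw [hterm]
  rw [← he, coeff_taylorSeries _ ha]

/-! ### Measurability of power series -/

/-- The radii `1 - 1/(i+2)` increase to `1`, so countably many tests suffice. Stated with extended
nonnegative sums, the condition is visibly measurable. -/
theorem converges_iff (a : ℕ → ℂ) : Converges a ↔
    ∀ i : ℕ, ∑' k, ‖a k‖ₑ * ENNReal.ofReal (1 - 1 / (i + 2)) ^ k ≠ ∞ := by
  have h0 : ∀ i : ℕ, (0 : ℝ) ≤ 1 - 1 / (i + 2) := fun i => by
    rw [sub_nonneg, div_le_one (by positivity)]
    linarith [(Nat.cast_nonneg i : (0 : ℝ) ≤ i)]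
  have e : ∀ i k : ℕ, ‖a k‖ₑ * ENNReal.ofReal (1 - 1 / (i + 2)) ^ k =
      ENNReal.ofReal (‖a k‖ * (1 - 1 / (i + 2)) ^ k) := fun i k => by
    rw [ENNReal.ofReal_mul (norm_nonneg _), ENNReal.ofReal_pow (h0 i), ofReal_norm]
  simp_rw [e]
  constructor
  · intro h i
    exact (h _ (h0 i) (by simp; positivity)).tsum_ofReal_ne_top
  · intro h r hr hr1
    obtain ⟨i, hi⟩ := exists_nat_one_div_lt (sub_pos.mpr hr1)
    have hi2 : r ≤ 1 - 1 / (i + 2) := by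
      have : (1 : ℝ) / (i + 2) ≤ 1 / (i + 1) := by gcongr; linarith
      linarith
    have hsum : Summable fun k => ‖a k‖ * (1 - 1 / ((i : ℝ) + 2)) ^ k := by
      have := ENNReal.summable_toReal (h i)
      refine this.congr fun k => ?_
      exact ENNReal.toReal_ofReal (mul_nonneg (norm_nonneg _) (pow_nonneg (h0 i) k))
    refine hsum.of_nonneg_of_le (fun k => by positivity) fun k => ?_
    gcongr

theorem measurableSet_converges : MeasurableSet {a : ℕ → ℂ | Converges a} := by
  simp_rw [converges_iff, Set.ofPred_forall]
  refine MeasurableSet.iInter fun i => ?_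
  have : Measurable fun a : ℕ → ℂ =>
      ∑' k, ‖a k‖ₑ * ENNReal.ofReal (1 - 1 / ((i : ℝ) + 2)) ^ k :=
    Measurable.tsum fun k => by fun_prop
  exact (this (measurableSet_singleton ∞)).compl

/-- The differential `(∑_{k<N} a_k z^k)(dz)^m`. -/
noncomputable def polynomialDiff (m : ℝ) (N : ℕ) (a : ℕ → ℂ) : HDiff m :=
  ⟨⟨fun z => ∑ k ∈ Finset.range N, a k * (z : ℂ) ^ k, by fun_prop⟩,
    (show DifferentiableOn ℂ (fun z : ℂ => ∑ k ∈ Finset.range N, a k * z ^ k)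
      (Metric.ball 0 1) by fun_prop).congr (ext_eqOn fun _ => rfl)⟩

theorem continuous_polynomialDiff (m : ℝ) (N : ℕ) : Continuous (polynomialDiff m N) := by
  refine Continuous.subtype_mk (ContinuousMap.continuous_of_continuous_uncurry _ ?_) _
  change Continuous fun p : (ℕ → ℂ) × Metric.ball (0 : ℂ) 1 =>
    ∑ k ∈ Finset.range N, p.1 k * (p.2 : ℂ) ^ k
  fun_prop

/-- A compact subset of the disk lies in some `|z| ≤ r < 1`, where the Weierstrass test applies. -/
theorem tendsto_polynomialDiff (m : ℝ) {a : ℕ → ℂ} (ha : Converges a) :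
    Tendsto (fun N => polynomialDiff m N a) atTop (𝓝 (taylorSeries m a)) := by
  refine tendsto_subtype_rng.mpr
    (ContinuousMap.tendsto_iff_forall_isCompact_tendstoUniformlyOn.mpr fun K hK => ?_)
  have hr : ∃ r : ℝ, 0 ≤ r ∧ r < 1 ∧ ∀ z ∈ K, ‖(z : ℂ)‖ ≤ r := by
    rcases K.eq_empty_or_nonempty with rfl | hne
    · exact ⟨0, le_rfl, one_pos, by simp⟩
    · obtain ⟨z, _, hz⟩ := hK.exists_isMaxOn hne
        (f := fun z : Metric.ball (0 : ℂ) 1 => ‖(z : ℂ)‖) (by fun_prop)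
      exact ⟨‖(z : ℂ)‖, norm_nonneg _, mem_ball_zero_iff.mp z.2, fun w hw => hz hw⟩
  obtain ⟨r, h0, h1, hr⟩ := hr
  have := tendstoUniformlyOn_tsum_nat (f := fun k (z : Metric.ball (0 : ℂ) 1) => a k * (z : ℂ) ^ k)
    (ha r h0 h1) (s := K) fun k z hz => by
      rw [norm_mul, norm_pow]
      gcongr
      exact hr z hz
  convert this using 1
  · rfl
  · exact funext fun z => taylorSeries_apply m ha z

theorem measurable_taylorSeries (m : ℝ) : Measurable (taylorSeries m) := by
  classical
  -- The approximants are set to `0` off the convergence set, to agree there with the default value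
  -- of `taylorSeries`.
  refine measurable_of_tendsto_metrizable
    (f := fun N a => if Converges a then polynomialDiff m N a else 0)
    (fun N => Measurable.ite measurableSet_converges (continuous_polynomialDiff m N).measurable
      measurable_const) (tendsto_pi_nhds.mpr fun a => ?_)
  by_cases ha : Converges a
  · simpa only [if_pos ha] using tendsto_polynomialDiff m ha
  · simp only [if_neg ha]
    rw [show taylorSeries m a = 0 from dif_neg ha]
    exact tendsto_const_nhds

/-! ### The Gaussian measures as images of standard Gaussian sequences -/

/-- The law of a sequence of independent standard complex Gaussian variables. -/
noncomputable def gaussianSeq : Measure (ℕ → ℂ) := Measure.infinitePi fun _ => complexGaussian 1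

instance : IsProbabilityMeasure gaussianSeq := by
  unfold gaussianSeq
  infer_instance

/-- The sequence of Taylor coefficients of the Gaussian measure `ν_T^{(m)}`. -/
noncomputable def scaledSeq (m T : ℝ) (x : ℕ → ℂ) (k : ℕ) : ℂ :=
  (Real.sqrt (T / weight m k) : ℂ) * x k

theorem measurable_scaledSeq (m T : ℝ) : Measurable (scaledSeq m T) :=
  measurable_pi_lambda _ fun k => by unfold scaledSeq; fun_prop

theorem gaussian_eq_map (m T : ℝ) [Fact (0 < m)] (hT : 0 < T) :
    gaussian m T = gaussianSeq.map (fun x => taylorSeries m (scaledSeq m T x)) := by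
  have h : ∀ k, complexGaussian (T / weight m k).toNNReal =
      (complexGaussian 1).map (fun z => (Real.sqrt (T / weight m k) : ℂ) * z) := fun k => by
    have hp : 0 ≤ T / weight m k := (div_pos hT (weight_pos m k)).le
    rw [complexGaussian_map_mul, mul_one]
    congr 1
    ext
    rw [Real.coe_toNNReal _ hp]
    simp [Real.sq_sqrt hp]
  have h2 := Measure.infinitePi_map_pi (μ := fun _ : ℕ => complexGaussian 1)
    (f := fun k z => (Real.sqrt (T / weight m k) : ℂ) * z) fun k => by fun_prop
  rw [gaussian]
  simp_rw [h]
  rw [← h2]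
  exact Measure.map_map (measurable_taylorSeries m) (measurable_scaledSeq m T)

/-- For each test radius `r < 1` the expectation of `∑ |f_k| r^k` is finite, because `∑ B(k+1,2m)⁻¹
r^k` converges; hence the sum is almost surely finite. -/
theorem ae_converges_scaledSeq (m T : ℝ) [Fact (0 < m)] (hT : 0 < T) :
    ∀ᵐ x ∂gaussianSeq, Converges (scaledSeq m T x) := by
  simp_rw [converges_iff]
  refine ae_all_iff.mpr fun i => ?_
  set r : ℝ := 1 - 1 / (i + 2) with hr
  have h0 : 0 ≤ r := by
    rw [hr, sub_nonneg, div_le_one (by positivity)]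
    linarith [(Nat.cast_nonneg i : (0 : ℝ) ≤ i)]
  have h1 : r < 1 := by
    have : (0 : ℝ) < 1 / (i + 2) := by positivity
    linarith
  have hm : ∀ k, Measurable fun x : ℕ → ℂ => ‖scaledSeq m T x k‖ₑ * ENNReal.ofReal r ^ k :=
    fun k => by unfold scaledSeq; fun_prop
  -- From `|z| ≤ 1 + |z|²` and the second moment `2`.
  have hn : ∫⁻ z, ‖z‖ₑ ∂(complexGaussian 1) ≤ 3 := by
    calc ∫⁻ z, ‖z‖ₑ ∂(complexGaussian 1) ≤ ∫⁻ z, (1 + ‖z‖ₑ ^ 2) ∂(complexGaussian 1) := by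
          refine lintegral_mono fun z => ?_
          rcases le_total ‖z‖ₑ 1 with h | h
          · exact h.trans le_self_add
          · exact (le_self_pow h two_ne_zero).trans le_add_self
      _ = 3 := by
          rw [lintegral_add_left measurable_const, lintegral_enorm_sq_complexGaussian]
          norm_num
  have hk : ∀ k, ∫⁻ x, ‖scaledSeq m T x k‖ₑ * ENNReal.ofReal r ^ k ∂gaussianSeq ≤
      ENNReal.ofReal ((T + (weight m k)⁻¹) * r ^ k) * 3 := fun k => by
    have hw := weight_pos m k
    -- The crude bound `√(ab) ≤ a + b` splits the series into a geometric one and one already known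
    -- to converge.
    have hs : Real.sqrt (T / weight m k) ≤ T + (weight m k)⁻¹ := by
      refine Real.sqrt_le_iff.mpr ⟨by positivity, ?_⟩
      rw [div_eq_mul_inv]
      nlinarith [mul_pos hT (inv_pos.mpr hw), sq_nonneg (T), sq_nonneg (weight m k)⁻¹]
    have h2 : ∫⁻ x, ‖x k‖ₑ ∂gaussianSeq = ∫⁻ z, ‖z‖ₑ ∂(complexGaussian 1) := by
      rw [← Measure.infinitePi_map_eval (fun _ : ℕ => complexGaussian 1) k,
        lintegral_map (by fun_prop) (by fun_prop)]
      rfl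
    have h3 : ∀ x : ℕ → ℂ, ‖scaledSeq m T x k‖ₑ * ENNReal.ofReal r ^ k =
        ENNReal.ofReal (Real.sqrt (T / weight m k) * r ^ k) * ‖x k‖ₑ := fun x => by
      rw [scaledSeq, enorm_mul, ENNReal.ofReal_mul (Real.sqrt_nonneg _), ENNReal.ofReal_pow h0,
        ← ofReal_norm (Real.sqrt (T / weight m k) : ℂ), Complex.norm_real,
        Real.norm_of_nonneg (Real.sqrt_nonneg _)]
      ring
    simp_rw [h3]
    rw [lintegral_const_mul _ (by fun_prop), h2]
    gcongr
  have hfin : ∫⁻ x, ∑' k, ‖scaledSeq m T x k‖ₑ * ENNReal.ofReal r ^ k ∂gaussianSeq ≠ ∞ := by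
    rw [lintegral_tsum fun k => (hm k).aemeasurable]
    refine ne_top_of_le_ne_top ?_ (ENNReal.tsum_le_tsum hk)
    rw [ENNReal.tsum_mul_right]
    refine ENNReal.mul_ne_top (Summable.tsum_ofReal_ne_top ?_) (by norm_num)
    simp_rw [add_mul]
    exact ((summable_geometric_of_lt_one h0 h1).mul_left T).add (summable_inv_weight m r h0 h1)
  filter_upwards [ae_lt_top (Measurable.tsum hm) hfin] with x hx using hx.ne

/-- The random differential with law `ν_S^{(m)} ⊗ ν_T^{(n)}`. -/
noncomputable def productSeries (m n S T : ℝ) (p : (ℕ → ℂ) × (ℕ → ℂ)) : HDiff (m + n) :=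
  mulDiff m n (taylorSeries m (scaledSeq m S p.2), taylorSeries n (scaledSeq n T p.1))

theorem measurable_productSeries (m n S T : ℝ) : Measurable (productSeries m n S T) :=
  (continuous_mulDiff m n).measurable.comp
    ((((measurable_taylorSeries m).comp (measurable_scaledSeq m S)).comp measurable_snd).prodMk
      (((measurable_taylorSeries n).comp (measurable_scaledSeq n T)).comp measurable_fst))

theorem mulImage_gaussian (m n S T : ℝ) [Fact (0 < m)] [Fact (0 < n)] (hS : 0 < S) (hT : 0 < T) :
    mulImage (gaussian m S) (gaussian n T) =
      (gaussianSeq.prod gaussianSeq).map (productSeries m n S T) := by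
  have h1 : Measurable fun x => taylorSeries m (scaledSeq m S x) :=
    (measurable_taylorSeries m).comp (measurable_scaledSeq m S)
  have h2 : Measurable fun x => taylorSeries n (scaledSeq n T x) :=
    (measurable_taylorSeries n).comp (measurable_scaledSeq n T)
  -- The `H^m` factor is read from the second coordinate, so that the inner integral in Fubini's
  -- theorem runs over `x`; this is why the product measure is swapped.
  rw [mulImage, gaussian_eq_map m S hS, gaussian_eq_map n T hT, Measure.map_prod_map _ _ h1 h2,
    Measure.map_map (continuous_mulDiff m n).measurable (h1.prodMap h2),
    ← Measure.prod_swap, Measure.map_map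
      ((continuous_mulDiff m n).measurable.comp (h1.prodMap h2)) measurable_swap, Measure.prod_swap]
  rfl

/-- The formula holds only almost everywhere: where a random series diverges, `taylorSeries` is `0`.
-/
theorem ae_coeff_productSeries (m n S T : ℝ) [Fact (0 < m)] [Fact (0 < n)] (hS : 0 < S)
    (hT : 0 < T) : ∀ᵐ p ∂gaussianSeq.prod gaussianSeq, ∀ l,
    coeff (productSeries m n S T p) l = ∑ q ∈ Finset.HasAntidiagonal.antidiagonal l,
      scaledSeq m S p.2 q.1 * scaledSeq n T p.1 q.2 := by
  filter_upwards [Measure.quasiMeasurePreserving_fst.ae (ae_converges_scaledSeq n T hT),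
    Measure.quasiMeasurePreserving_snd.ae (ae_converges_scaledSeq m S hS)] with p h1 h2 l
  simp_rw [productSeries, coeff_mulDiff, coeff_taylorSeries _ h1, coeff_taylorSeries _ h2]

end Disk

namespace Disk

open Matrix
open scoped ComplexOrder

/-! ### Bilinear forms in Gaussian sequences -/

/-- The bilinear form with matrix `β` in the conjugates of two sequences. -/
noncomputable def bilinearForm {s : Finset ℕ} (β : Matrix s s ℂ) (p : (ℕ → ℂ) × (ℕ → ℂ)) : ℂ :=
  ∑ j, (∑ k, β k j * conj (p.1 k)) * conj (p.2 j)

@[fun_prop]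
theorem measurable_bilinearForm {s : Finset ℕ} (β : Matrix s s ℂ) : Measurable (bilinearForm β) := by
  unfold bilinearForm
  fun_prop

/-- The form involves only the coordinates in `s`, so after Fubini both infinite products of
Gaussians restrict to finite ones. -/
theorem integral_cexp_bilinearForm {s : Finset ℕ} (β : Matrix s s ℂ) :
    ∫ p, Complex.exp (-Complex.I * ((bilinearForm β p).re : ℂ)) ∂gaussianSeq.prod gaussianSeq =
      1 / (1 + β * βᴴ).det := by
  have hm : Measurable fun p : (s → ℂ) × (s → ℂ) => Complex.exp (-Complex.I *
      ((∑ j, (∑ k, β k j * conj (p.1 k)) * conj (p.2 j)).re : ℂ)) := by fun_prop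
  have h1 : ∀ y : ℕ → ℂ, ∫ x, Complex.exp (-Complex.I * ((bilinearForm β (y, x)).re : ℂ))
      ∂gaussianSeq = ∫ x : s → ℂ, Complex.exp (-Complex.I *
        ((∑ j, (∑ k, β k j * conj (s.restrict y k)) * conj (x j)).re : ℂ))
        ∂(Measure.pi fun _ => complexGaussian 1) := fun y =>
    integral_restrict_infinitePi (μ := fun _ => complexGaussian 1)
      (f := fun x : s → ℂ => Complex.exp (-Complex.I *
        ((∑ j, (∑ k, β k j * conj (s.restrict y k)) * conj (x j)).re : ℂ)))
      (hm.comp (measurable_const.prodMk measurable_id)).aestronglyMeasurable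
  rw [integral_prod, ← integral_cexp_bilinear β]
  · simp_rw [h1]
    exact integral_restrict_infinitePi (μ := fun _ => complexGaussian 1)
      (f := fun y : s → ℂ => ∫ x : s → ℂ, Complex.exp (-Complex.I *
        ((∑ j, (∑ k, β k j * conj (y k)) * conj (x j)).re : ℂ))
        ∂(Measure.pi fun _ => complexGaussian 1))
      hm.stronglyMeasurable.integral_prod_right.aestronglyMeasurable
  · refine Integrable.of_bound (C := 1) (by fun_prop) (ae_of_all _ fun p => ?_)
    rw [neg_mul, ← mul_neg, ← Complex.ofReal_neg, Complex.norm_exp_I_mul_ofReal]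

theorem lintegral_enorm_sq_bilinearForm {s : Finset ℕ} (β : Matrix s s ℂ) :
    ∫⁻ p, ‖bilinearForm β p‖ₑ ^ 2 ∂gaussianSeq.prod gaussianSeq =
      4 * ∑ j, ∑ k, ‖β k j‖ₑ ^ 2 := by
  have hm : Measurable fun p : (s → ℂ) × (s → ℂ) =>
      ‖∑ j, (∑ k, β k j * conj (p.1 k)) * conj (p.2 j)‖ₑ ^ 2 := by fun_prop
  have h1 : ∀ y : ℕ → ℂ, ∫⁻ x, ‖bilinearForm β (y, x)‖ₑ ^ 2 ∂gaussianSeq =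
      ∫⁻ x : s → ℂ, ‖∑ j, (∑ k, β k j * conj (s.restrict y k)) * conj (x j)‖ₑ ^ 2
        ∂(Measure.pi fun _ => complexGaussian 1) := fun y =>
    lintegral_restrict_infinitePi (μ := fun _ => complexGaussian 1)
      (f := fun x : s → ℂ => ‖∑ j, (∑ k, β k j * conj (s.restrict y k)) * conj (x j)‖ₑ ^ 2)
      (by fun_prop)
  refine Eq.trans ?_ (lintegral_enorm_sq_bilinear β)
  rw [lintegral_prod _ (by fun_prop), lintegral_congr h1]
  exact lintegral_restrict_infinitePi (μ := fun _ => complexGaussian 1)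
    (f := fun y : s → ℂ => ∫⁻ x : s → ℂ,
      ‖∑ j, (∑ k, β k j * conj (y k)) * conj (x j)‖ₑ ^ 2
        ∂(Measure.pi fun _ => complexGaussian 1)) hm.lintegral_prod_right'

/-! ### The pairings under the multiplicative image -/

/-- Summing over antidiagonals below `N` fills the triangle `k + j < N` of the square. The cutoff is
the one that truncating `F` imposes on its Hankel matrix. -/
theorem sum_range_antidiagonal {M : Type*} [AddCommMonoid M] (N : ℕ) (g : ℕ → ℕ → M) :
    ∑ l ∈ Finset.range N, ∑ q ∈ Finset.HasAntidiagonal.antidiagonal l, g q.1 q.2 =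
      ∑ j : Finset.range N, ∑ k : Finset.range N, if (k : ℕ) + j < N then g j k else 0 := by
  have e : (∑ j : Finset.range N, ∑ k : Finset.range N, if (k : ℕ) + j < N then g j k else 0) =
      ∑ j ∈ Finset.range N, ∑ k ∈ Finset.range N, if k + j < N then g j k else 0 := by
    rw [← Finset.sum_coe_sort (Finset.range N)
      (fun j => ∑ k ∈ Finset.range N, if k + j < N then g j k else 0)]
    exact Finset.sum_congr rfl fun j _ => Finset.sum_coe_sort (Finset.range N)
      (fun k => if k + j < N then g j k else 0)
  rw [e, ← Finset.sum_product' _ _ (fun j k => if k + j < N then g j k else 0), ← Finset.sum_filter,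
    ← Finset.sum_fiberwise_of_maps_to (t := Finset.range N) (g := fun q : ℕ × ℕ => q.1 + q.2)]
  · refine Finset.sum_congr rfl fun l hl => Finset.sum_congr ?_ fun _ _ => rfl
    ext q
    simp only [Finset.HasAntidiagonal.mem_antidiagonal, Finset.mem_filter, Finset.mem_product,
      Finset.mem_range] at hl ⊢
    omega
  · intro q hq
    simp only [Finset.mem_filter, Finset.mem_range] at hq ⊢
    omega

section Pairing

variable {m n : ℝ} [Fact (0 < m)] [Fact (0 < n)]

/-- The standard deviations `√(S/B(j+1,2m))` and `√(T/B(k+1,2n))`, multiplied by `B(k+j+1,2m+2n)`,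
give exactly `√(ST)` times the normalisation of the orthonormal Hankel matrix. -/
theorem ae_partialPairing_productSeries (F : HL2 (m + n)) (N : ℕ) {S T : ℝ} (hS : 0 < S)
    (hT : 0 < T) : ∀ᵐ p ∂gaussianSeq.prod gaussianSeq,
    partialPairing F N (productSeries m n S T p) =
      bilinearForm ((Real.sqrt (S * T) : ℂ) • hankelSection (truncate N F) N) p := by
  filter_upwards [ae_coeff_productSeries m n S T hS hT] with p hp
  have h1 : ∀ l, F.coeff l * conj (coeff (productSeries m n S T p) l) * (weight (m + n) l : ℂ) =
      ∑ q ∈ Finset.HasAntidiagonal.antidiagonal l, F.coeff (q.2 + q.1) *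
        conj (scaledSeq m S p.2 q.1 * scaledSeq n T p.1 q.2) * (weight (m + n) (q.2 + q.1) : ℂ) := by
    intro l
    rw [hp, map_sum, Finset.mul_sum, Finset.sum_mul]
    refine Finset.sum_congr rfl fun q hq => ?_
    rw [add_comm q.2, Finset.HasAntidiagonal.mem_antidiagonal.mp hq]
  rw [partialPairing, Finset.sum_congr rfl fun l _ => h1 l,
    sum_range_antidiagonal N fun j k => F.coeff (k + j) *
      conj (scaledSeq m S p.2 j * scaledSeq n T p.1 k) * (weight (m + n) (k + j) : ℂ), bilinearForm]
  refine Finset.sum_congr rfl fun j _ => ?_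
  rw [Finset.sum_mul]
  refine Finset.sum_congr rfl fun k _ => ?_
  simp only [Matrix.smul_apply, hankelSection, submatrix_apply, hankelMatrix, of_apply,
    coeff_truncate, smul_eq_mul]
  split_ifs
  · simp only [scaledSeq, map_mul, Complex.conj_ofReal]
    rw [Real.sqrt_div hS.le, Real.sqrt_div hT.le, Real.sqrt_mul hS.le]
    push_cast
    ring
  · simp

/-- On each antidiagonal `k + j = l` the factor `|F_l|²` is constant and the weights are summed by
`sum_inv_weight`: the Hilbert–Schmidt norm is the norm of the Taylor polynomial. -/
theorem sum_norm_hankelSection_truncate (F : HL2 (m + n)) (N : ℕ) :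
    ∑ j, ∑ k, ‖hankelSection (truncate N F) N k j‖ ^ 2 =
      ∑ l ∈ Finset.range N, ‖F.coeff l‖ ^ 2 * weight (m + n) l := by
  have h : ∀ l, ‖F.coeff l‖ ^ 2 * weight (m + n) l =
      ∑ q ∈ Finset.HasAntidiagonal.antidiagonal l, ‖F.coeff (q.2 + q.1)‖ ^ 2 *
        weight (m + n) (q.2 + q.1) ^ 2 * ((weight m q.1)⁻¹ * (weight n q.2)⁻¹) := fun l => by
    have e : ∀ q ∈ Finset.HasAntidiagonal.antidiagonal l, ‖F.coeff (q.2 + q.1)‖ ^ 2 *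
        weight (m + n) (q.2 + q.1) ^ 2 * ((weight m q.1)⁻¹ * (weight n q.2)⁻¹) =
        ‖F.coeff l‖ ^ 2 * weight (m + n) l ^ 2 * ((weight m q.1)⁻¹ * (weight n q.2)⁻¹) :=
      fun q hq => by rw [add_comm q.2, Finset.HasAntidiagonal.mem_antidiagonal.mp hq]
    have hw := weight_pos (m + n) l
    rw [Finset.sum_congr rfl e, ← Finset.mul_sum, sum_inv_weight]
    field_simp
  rw [Finset.sum_congr rfl fun l _ => h l, sum_range_antidiagonal N fun j k =>
    ‖F.coeff (k + j)‖ ^ 2 * weight (m + n) (k + j) ^ 2 * ((weight m j)⁻¹ * (weight n k)⁻¹)]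
  refine Finset.sum_congr rfl fun j _ => Finset.sum_congr rfl fun k _ => ?_
  simp only [hankelSection, submatrix_apply, hankelMatrix, of_apply, coeff_truncate]
  have h1 := weight_pos n k
  have h2 := weight_pos m j
  split_ifs
  · simp only [norm_mul, Complex.norm_real, mul_pow, Real.norm_eq_abs, sq_abs, div_pow,
      Real.sq_sqrt h1.le, Real.sq_sqrt h2.le]
    field_simp
  · simp

@[fun_prop]
theorem measurable_partialPairing {m : ℝ} [Fact (0 < m)] (F : HL2 m) (N : ℕ) :
    Measurable (partialPairing F N) := by
  have : ∀ k, Measurable fun f : HDiff m => coeff f k := fun k => (continuous_coeff k).measurable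
  unfold partialPairing
  fun_prop

theorem HL2.coeff_sub {m : ℝ} [Fact (0 < m)] (F G : HL2 m) (k : ℕ) :
    (F - G).coeff k = F.coeff k - G.coeff k := by
  rw [eq_sub_iff_add_eq, ← HL2.coeff_add, sub_add_cancel]

theorem partialPairing_sub {m : ℝ} [Fact (0 < m)] (F G : HL2 m) (N : ℕ) :
    partialPairing (F - G) N = partialPairing F N - partialPairing G N := by
  ext f
  simp only [partialPairing, HL2.coeff_sub, Pi.sub_apply, ← Finset.sum_sub_distrib]
  exact Finset.sum_congr rfl fun k _ => by ring

theorem partialPairing_truncate {m : ℝ} [Fact (0 < m)] (F : HL2 m) {M N : ℕ} (h : M ≤ N) :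
    partialPairing (truncate M F) N = partialPairing F M := by
  ext f
  simp only [partialPairing, coeff_truncate]
  rw [← Finset.sum_subset (Finset.range_mono h) fun k _ hk => by
    rw [if_neg (by simpa using hk)]
    simp]
  exact Finset.sum_congr rfl fun k hk => by rw [if_pos (by simpa using hk)]

/-- The key isometry: up to the factor `4ST`, the second moment of the pairing is the squared norm
of the Taylor polynomial, which controls both continuity in `F` and convergence in `N`. -/
theorem lintegral_enorm_sq_partialPairing {S T : ℝ} (hS : 0 < S) (hT : 0 < T) (F : HL2 (m + n))
    (N : ℕ) :
    ∫⁻ f, ‖partialPairing F N f‖ₑ ^ 2 ∂mulImage (gaussian m S) (gaussian n T) =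
      ENNReal.ofReal (4 * (S * T) *
        ∑ l ∈ Finset.range N, ‖F.coeff l‖ ^ 2 * weight (m + n) l) := by
  have hST : 0 < S * T := mul_pos hS hT
  have e : ∀ k j, ‖((Real.sqrt (S * T) : ℂ) • hankelSection (truncate N F) N) k j‖ₑ ^ 2 =
      ENNReal.ofReal (S * T * ‖hankelSection (truncate N F) N k j‖ ^ 2) := fun k j => by
    rw [Matrix.smul_apply, ← ofReal_norm, ← ENNReal.ofReal_pow (norm_nonneg _), norm_smul, mul_pow,
      Complex.norm_real, Real.norm_eq_abs, sq_abs, Real.sq_sqrt hST.le]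
  rw [mulImage_gaussian m n S T hS hT, lintegral_map (by fun_prop)
    (measurable_productSeries m n S T)]
  rw [lintegral_congr_ae ((ae_partialPairing_productSeries F N hS hT).mono fun p hp =>
    show _ = ‖bilinearForm _ p‖ₑ ^ 2 by rw [hp]), lintegral_enorm_sq_bilinearForm,
    ← sum_norm_hankelSection_truncate]
  simp_rw [e, ← ENNReal.ofReal_sum_of_nonneg fun _ _ => mul_nonneg hST.le (sq_nonneg _)]
  rw [← ENNReal.ofReal_sum_of_nonneg fun _ _ => Finset.sum_nonneg fun _ _ =>
      mul_nonneg hST.le (sq_nonneg _), show (4 : ℝ≥0∞) = ENNReal.ofReal 4 by norm_num,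
    ← ENNReal.ofReal_mul (by norm_num)]
  simp_rw [← Finset.mul_sum, mul_assoc]

end Pairing

end Disk

/-! ### The Fourier transform on all of `H^(m+n) ∩ L²` -/

namespace Disk

open Matrix
open scoped ComplexOrder

section Transform

variable {m n : ℝ} [Fact (0 < m)] [Fact (0 < n)] {S T : ℝ}

theorem isProbabilityMeasure_mulImage_gaussian (hS : 0 < S) (hT : 0 < T) :
    IsProbabilityMeasure (mulImage (gaussian m S) (gaussian n T)) := by
  rw [mulImage_gaussian m n S T hS hT]
  exact Measure.isProbabilityMeasure_map (measurable_productSeries m n S T).aemeasurable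

theorem integral_partialPairing (hS : 0 < S) (hT : 0 < T) (F : HL2 (m + n)) (N : ℕ) :
    ∫ f, Complex.exp (-Complex.I * ((partialPairing F N f).re : ℂ))
      ∂mulImage (gaussian m S) (gaussian n T) = 1 / hankelDet (S * T) (truncate N F) := by
  have h : ∀ᵐ p ∂gaussianSeq.prod gaussianSeq,
      Complex.exp (-Complex.I * ((partialPairing F N (productSeries m n S T p)).re : ℂ)) =
      Complex.exp (-Complex.I * ((bilinearForm
        ((Real.sqrt (S * T) : ℂ) • hankelSection (truncate N F) N) p).re : ℂ)) := by
    filter_upwards [ae_partialPairing_productSeries F N hS hT] with p hp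
    rw [hp]
  rw [mulImage_gaussian m n S T hS hT, integral_map (measurable_productSeries m n S T).aemeasurable
    (by fun_prop), integral_congr_ae h, integral_cexp_bilinearForm,
    hankelDet_of_polynomial (N := N) (fun k hk => by
      rw [coeff_truncate, if_neg (by omega)]) _ (mul_pos hS hT).le]

/-- The reciprocal is the integral of a unimodular function against a probability measure, so its
modulus is at most `1`. This uniform lower bound keeps the limit away from zero. -/
theorem one_le_norm_hankelDet_truncate (hS : 0 < S) (hT : 0 < T) (F : HL2 (m + n)) (N : ℕ) :
    1 ≤ ‖hankelDet (S * T) (truncate N F)‖ := by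
  have h0 : hankelDet (S * T) (truncate N F) ≠ 0 := by
    rw [hankelDet_of_polynomial (N := N) (fun k hk => by
      rw [coeff_truncate, if_neg (by omega)]) _ (mul_pos hS hT).le]
    -- Nonvanishing is needed separately, since `1 / 0 = 0` would also satisfy the integral bound.
    exact (PosDef.one.add_posSemidef (posSemidef_self_mul_conjTranspose _)).det_pos.ne'
  have := isProbabilityMeasure_mulImage_gaussian (m := m) (n := n) hS hT
  have h1 := norm_integral_le_of_norm_le_const (μ := mulImage (gaussian m S) (gaussian n T)) (C := 1)
    (f := fun f => Complex.exp (-Complex.I * ((partialPairing F N f).re : ℂ)))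
    (ae_of_all _ fun f => by
      rw [neg_mul, ← mul_neg, ← Complex.ofReal_neg, Complex.norm_exp_I_mul_ofReal])
  rw [integral_partialPairing hS hT, norm_div, norm_one, probReal_univ, mul_one] at h1
  exact (div_le_one (norm_pos_iff.mpr h0)).mp h1

theorem hankelDet_ne_zero (hS : 0 < S) (hT : 0 < T) (F : HL2 (m + n)) :
    hankelDet (S * T) F ≠ 0 := by
  have h := ge_of_tendsto (tendsto_hankelDet_truncate (S * T) (mul_pos hS hT).le F).norm
    (Eventually.of_forall (one_le_norm_hankelDet_truncate hS hT F))
  exact norm_pos_iff.mp (one_pos.trans_le h)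

theorem tendsto_one_div_hankelDet (hS : 0 < S) (hT : 0 < T) (F : HL2 (m + n)) :
    Tendsto (fun N => 1 / hankelDet (S * T) (truncate N F)) atTop
      (𝓝 (1 / hankelDet (S * T) F)) :=
  tendsto_const_nhds.div (tendsto_hankelDet_truncate (S * T) (mul_pos hS hT).le F)
    (hankelDet_ne_zero hS hT F)

/-- Since `t ↦ exp(-it)` is `1`-Lipschitz, the difference is bounded by the `L¹` distance, hence by
the `L²` distance on a probability space. -/
theorem enorm_integral_cexp_sub_le {α : Type*} [MeasurableSpace α] {μ : Measure α}
    [IsProbabilityMeasure μ] {u v : α → ℂ} (hu : AEStronglyMeasurable u μ)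
    (hv : AEStronglyMeasurable v μ) :
    ‖∫ x, Complex.exp (-Complex.I * ((u x).re : ℂ)) ∂μ -
      ∫ x, Complex.exp (-Complex.I * ((v x).re : ℂ)) ∂μ‖ₑ ≤ eLpNorm (u - v) 2 μ := by
  have hi : ∀ {w : α → ℂ}, AEStronglyMeasurable w μ →
      Integrable (fun x => Complex.exp (-Complex.I * ((w x).re : ℂ))) μ := fun {w} hw => by
    refine Integrable.of_bound (C := 1) ?_ (ae_of_all _ fun x => ?_)
    · exact (by fun_prop : Continuous fun z : ℂ =>
        Complex.exp (-Complex.I * (z.re : ℂ))).comp_aestronglyMeasurable hw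
    · rw [neg_mul, ← mul_neg, ← Complex.ofReal_neg, Complex.norm_exp_I_mul_ofReal]
  have hb : ∀ x, ‖Complex.exp (-Complex.I * ((u x).re : ℂ)) -
      Complex.exp (-Complex.I * ((v x).re : ℂ))‖ₑ ≤ ‖(u - v) x‖ₑ := fun x => by
    have e : Complex.exp (-Complex.I * ((u x).re : ℂ)) - Complex.exp (-Complex.I * ((v x).re : ℂ)) =
        Complex.exp (Complex.I * ((-(v x).re : ℝ) : ℂ)) *
          (Complex.exp (Complex.I * (((v x).re - (u x).re : ℝ) : ℂ)) - 1) := by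
      rw [mul_sub, ← Complex.exp_add]
      push_cast
      ring_nf
    rw [e, enorm_mul, Complex.enorm_exp_I_mul_ofReal, one_mul]
    refine Real.enorm_exp_I_mul_ofReal_sub_one_le.trans ?_
    rw [← ofReal_norm, ← ofReal_norm]
    refine ENNReal.ofReal_le_ofReal ?_
    rw [norm_sub_rev, ← Complex.sub_re]
    exact Complex.abs_re_le_norm _
  rw [← integral_sub (hi hu) (hi hv)]
  refine (enorm_integral_le_lintegral_enorm _).trans ((lintegral_mono hb).trans ?_)
  rw [← eLpNorm_one_eq_lintegral_enorm]
  exact eLpNorm_le_eLpNorm_of_exponent_le one_le_two (hu.sub hv)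

theorem eLpNorm_partialPairing (hS : 0 < S) (hT : 0 < T) (F : HL2 (m + n)) (N : ℕ) :
    eLpNorm (partialPairing F N) 2 (mulImage (gaussian m S) (gaussian n T)) =
      ENNReal.ofReal (Real.sqrt (4 * (S * T) *
        ∑ l ∈ Finset.range N, ‖F.coeff l‖ ^ 2 * weight (m + n) l)) := by
  have h0 : 0 ≤ ∑ l ∈ Finset.range N, ‖F.coeff l‖ ^ 2 * weight (m + n) l :=
    Finset.sum_nonneg fun l _ => mul_nonneg (sq_nonneg _) (weight_pos _ _).le
  have hST := mul_pos hS hT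
  rw [eLpNorm_eq_lintegral_rpow_enorm_toReal two_ne_zero ENNReal.ofNat_ne_top]
  simp only [ENNReal.toReal_ofNat, ENNReal.rpow_ofNat]
  rw [lintegral_enorm_sq_partialPairing hS hT, ENNReal.ofReal_rpow_of_nonneg (by positivity)
    (by positivity), Real.sqrt_eq_rpow]

theorem memLp_partialPairing (hS : 0 < S) (hT : 0 < T) (F : HL2 (m + n)) (N : ℕ) :
    MemLp (partialPairing F N) 2 (mulImage (gaussian m S) (gaussian n T)) :=
  ⟨(measurable_partialPairing F N).aestronglyMeasurable, by
    rw [eLpNorm_partialPairing hS hT]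
    exact ENNReal.ofReal_lt_top⟩

/-- For truncations both terms are integrals, whose difference is controlled by the second moment of
the pairing with `F - G`; the bound is uniform in `N` and passes to the limit. Continuity thus comes
from the measure rather than from the determinant. -/
theorem norm_sub_hankelDet_le (hS : 0 < S) (hT : 0 < T) (F G : HL2 (m + n)) :
    ‖1 / hankelDet (S * T) F - 1 / hankelDet (S * T) G‖ ≤
      Real.sqrt (4 * (S * T)) * ‖F - G‖ := by
  have := isProbabilityMeasure_mulImage_gaussian (m := m) (n := n) hS hT
  refine le_of_tendsto ((tendsto_one_div_hankelDet hS hT F).sub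
    (tendsto_one_div_hankelDet hS hT G)).norm (Eventually.of_forall fun N => ?_)
  have h := enorm_integral_cexp_sub_le (μ := mulImage (gaussian m S) (gaussian n T))
    (measurable_partialPairing F N).aestronglyMeasurable
    (measurable_partialPairing G N).aestronglyMeasurable
  rw [integral_partialPairing hS hT, integral_partialPairing hS hT, ← partialPairing_sub,
    eLpNorm_partialPairing hS hT, ← ofReal_norm,
    ENNReal.ofReal_le_ofReal_iff (Real.sqrt_nonneg _)] at h
  refine h.trans ?_
  rw [Real.sqrt_mul (mul_pos four_pos (mul_pos hS hT)).le]
  refine mul_le_mul_of_nonneg_left (Real.sqrt_le_iff.mpr ⟨norm_nonneg _, ?_⟩) (Real.sqrt_nonneg _)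
  rw [HL2.norm_sq_eq]
  exact (F - G).summable.sum_le_tsum _ fun l _ => mul_nonneg (sq_nonneg _) (weight_pos _ _).le

theorem continuous_one_div_hankelDet (hS : 0 < S) (hT : 0 < T) :
    Continuous fun F : HL2 (m + n) => 1 / hankelDet (S * T) F := by
  refine (LipschitzWith.of_dist_le_mul (K := (Real.sqrt (4 * (S * T))).toNNReal)
    fun F G => ?_).continuous
  rw [Real.coe_toNNReal _ (Real.sqrt_nonneg _), dist_eq_norm, dist_eq_norm]
  exact norm_sub_hankelDet_le hS hT F G

theorem eLpNorm_partialPairing_sub (hS : 0 < S) (hT : 0 < T) (F : HL2 (m + n)) {M N : ℕ}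
    (h : M ≤ N) : eLpNorm (partialPairing F N - partialPairing F M) 2
      (mulImage (gaussian m S) (gaussian n T)) =
      ENNReal.ofReal (Real.sqrt (4 * (S * T) *
        (∑ l ∈ Finset.range N, ‖F.coeff l‖ ^ 2 * weight (m + n) l -
          ∑ l ∈ Finset.range M, ‖F.coeff l‖ ^ 2 * weight (m + n) l))) := by
  have e : ∑ l ∈ Finset.range M, ‖F.coeff l‖ ^ 2 * weight (m + n) l =
      ∑ l ∈ Finset.range N, if l < M then ‖F.coeff l‖ ^ 2 * weight (m + n) l else 0 := by
    rw [← Finset.sum_filter]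
    refine Finset.sum_congr ?_ fun _ _ => rfl
    ext l
    simp only [Finset.mem_range, Finset.mem_filter]
    omega
  rw [← partialPairing_truncate F h, ← partialPairing_sub, eLpNorm_partialPairing hS hT, e,
    ← Finset.sum_sub_distrib]
  congr 3
  refine Finset.sum_congr rfl fun l _ => ?_
  rw [HL2.coeff_sub, coeff_truncate]
  split_ifs <;> simp

/-- The limit `X` is taken in `L²`, where the pairings are Cauchy by the isometry. Convergence in
`L²` implies convergence in measure and, by the Lipschitz bound, convergence of the integrals. -/
theorem isFourierTransform_one_div_hankelDet (hS : 0 < S) (hT : 0 < T) :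
    IsFourierTransform (mulImage (gaussian m S) (gaussian n T))
      fun F => 1 / hankelDet (S * T) F where
  eq_integral_of_polynomial F N hF := by
    have e : truncate N F = F := HL2.ext_coeff fun k => by
      rw [coeff_truncate]
      split_ifs with hk
      · rfl
      · exact (hF k (not_lt.mp hk)).symm
    rw [integral_partialPairing hS hT, e]
  continuous := continuous_one_div_hankelDet hS hT
  eq_integral F := by
    have := isProbabilityMeasure_mulImage_gaussian (m := m) (n := n) hS hT
    set μ := mulImage (gaussian m S) (gaussian n T)
    set s : ℕ → ℝ := fun N => ∑ l ∈ Finset.range N, ‖F.coeff l‖ ^ 2 * weight (m + n) l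
    set u : ℕ → Lp ℂ 2 μ := fun N => (memLp_partialPairing hS hT F N).toLp (partialPairing F N)
    have hST : 0 ≤ 4 * (S * T) := (mul_pos four_pos (mul_pos hS hT)).le
    have hd : ∀ {M N : ℕ}, M ≤ N → dist (u N) (u M) = Real.sqrt (4 * (S * T) * (s N - s M)) :=
      fun {M N} h => by
        rw [dist_eq_norm, ← MemLp.toLp_sub, Lp.norm_toLp, eLpNorm_partialPairing_sub hS hT F h,
          ENNReal.toReal_ofReal (Real.sqrt_nonneg _)]
    have hcs : CauchySeq s := F.summable.hasSum.tendsto_sum_nat.cauchySeq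
    have hcu : CauchySeq u := by
      refine Metric.cauchySeq_iff'.mpr fun ε hε => ?_
      -- The squared `L²` distance is `4ST (s N - s M)`, whence this tolerance.
      obtain ⟨M, hM⟩ := Metric.cauchySeq_iff'.mp hcs (ε ^ 2 / (4 * (S * T))) (by positivity)
      refine ⟨M, fun N hN => ?_⟩
      rw [hd hN, Real.sqrt_lt' hε]
      have h1 := hM N hN
      rw [Real.dist_eq, lt_div_iff₀' (by positivity)] at h1
      exact (mul_le_mul_of_nonneg_left (le_abs_self _) hST).trans_lt h1
    obtain ⟨X, hX⟩ := cauchySeq_tendsto_of_complete hcu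
    have hXm : AEStronglyMeasurable X μ := Lp.aestronglyMeasurable X
    refine ⟨X, hXm, ?_, ?_⟩
    · exact (tendstoInMeasure_of_tendsto_Lp hX).congr_left fun N =>
        (memLp_partialPairing hS hT F N).coeFn_toLp
    -- The integrals for the Taylor polynomials equal `1/det` of the truncations; they tend both to
    -- `1/det` for `F` and to the integral for `X`.
    · refine tendsto_nhds_unique (tendsto_one_div_hankelDet hS hT F) ?_
      refine tendsto_iff_edist_tendsto_0.mpr ?_
      have h0 := tendsto_iff_edist_tendsto_0.mp hX
      refine tendsto_of_tendsto_of_tendsto_of_le_of_le tendsto_const_nhds h0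
        (fun _ => zero_le) fun N => ?_
      rw [← integral_partialPairing hS hT, edist_eq_enorm_sub, Lp.edist_def]
      refine (enorm_integral_cexp_sub_le
        (measurable_partialPairing F N).aestronglyMeasurable hXm).trans (le_of_eq ?_)
      exact eLpNorm_congr_ae ((memLp_partialPairing hS hT F N).coeFn_toLp.symm.sub EventuallyEq.rfl)

end Transform

end Disk

theorem mainTheorem4 (m n : ℝ) [Fact (0 < m)] [Fact (0 < n)] (S T : ℝ) (hS : 0 < S) (hT : 0 < T) :
    (∀ F : Disk.HL2 (m + n),
      (Summable fun j => ‖Disk.hankelOp m n F (Disk.HL2.basis m j)‖ ^ 2) ∧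
      Summable (Disk.principalMinor (Disk.HL2.basis n)
        (((S * T : ℝ) : ℂ) • (Disk.hankelOp m n F ∘L
          ContinuousLinearMap.adjoint (Disk.hankelOp m n F))))) ∧
    Disk.IsFourierTransform (Disk.mulImage (Disk.gaussian m S) (Disk.gaussian n T))
      (fun F => 1 / Disk.fredholmDet (Disk.HL2.basis n)
        (((S * T : ℝ) : ℂ) • (Disk.hankelOp m n F ∘L
          ContinuousLinearMap.adjoint (Disk.hankelOp m n F)))) :=
  ⟨fun F => ⟨Disk.summable_norm_hankelOp_basis F,
    Disk.summable_principalMinor F (S * T) (mul_pos hS hT).le⟩,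
    Disk.isFourierTransform_one_div_hankelDet hS hT⟩
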